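/- Let $\mathbb K\in\{\mathbb R,\mathbb C\}$, let $X$ be a compact Hausdorff space, and let $\mathcal E,\mathcal F$ be Banach bundles over $X$ (locally trivial, with a Banach space as model fibre and norm continuous transition functions). A morphism $L:\mathcal E\to\mathcal F$ is a family of bounded operators $L_\lambda:\mathcal E_\lambda\to\mathcal F_\lambda$, $\lambda\in X$, that is continuous in the operator norm in local trivializations; it belongs to $\mathfrak F(\mathcal E,\mathcal F)$ (is a Fredholm morphism) if there is a $k\in\mathbb Z$ such that every $L_\lambda$ is a Fredholm operator of index $k$. A subbundle of a Banach bundle (a family of closed subspaces of the fibres, with its own model fibre, that is constant in suitable local trivializations) is again a Banach bundle; it is called direct if each of its fibres is a complemented subspace of the corresponding fibre. A subbundle $\mathcal V\subset\mathcal F$ is transversal to $\operatorname{im}(L)$ if $$\operatorname{im}(L_\lambda)+\mathcal V_\lambda=\mathcal F_\lambda\qquad\text{for all }\lambda\in X,$$ and $E(L,\mathcal V)$ denotes the family of the spaces $E(L,\mathcal V)_\lambda=L_\lambda^{-1}(\mathcal V_\lambda)\subset\mathcal E_\lambda$. Let $K(X)$ be the Grothendieck group of the isomorphism classes of finite dimensional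 $\mathbb K$-vector bundles over $X$. The index bundle of a Fredholm morphism $L$ is $$\operatorname{ind}(L)=[E(L,\mathcal W)]-[\mathcal W]\in K(X),$$ where $\mathcal W\subset\mathcal F$ is any finite dimensional subbundle transversal to $\operatorname{im}(L)$; such $\mathcal W$ exist, $E(L,\mathcal W)$ is then a finite dimensional subbundle of $\mathcal E$, and the element does not depend on the choice of $\mathcal W$. Let $L\in\mathfrak F(\mathcal E,\mathcal F)$, and let $\mathcal V$ be a (possibly infinite dimensional) direct subbundle of $\mathcal F$ which is transversal to $\operatorname{im}(L)$ and such that $L_\lambda^{-1}(\mathcal V_\lambda)$ is a complemented subspace of $\mathcal E_\lambda$ for all $\lambda\in X$. Then $E(L,\mathcal V)$ is a direct subbundle of $\mathcal E$, the restriction $\tilde L:=L|_{E(L,\mathcal V)}$ is an element of $\mathfrak F(E(L,\mathcal V),\mathcal V)$, and $$\operatorname{ind} L=\operatorname{ind}\tilde L\in K(X).$$ -/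

import Mathlib

open Bundle Topology

universe v w u y z

noncomputable section

/-! ### Finite dimensional vector bundles and the group `K(X)` -/

/-- A finite dimensional `𝕜`-vector bundle over `X` (the rank may vary from one component of `X` to
another): a family of vector spaces with a topology on the total space such that the projection is
continuous and every point of `X` has an open neighbourhood `U` over which the total space is
homeomorphic to `U × 𝕜ⁿ`, fibrewise linearly and over `U`. The local trivialization over `U` is
given by `φ`, its inverse by `ψ`; both are irrelevant outside of `U`. -/
structure FinVectorBundle (𝕜 : Type w) [RCLike 𝕜] (X : Type u) [TopologicalSpace X] where
  /-- the fibres -/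
  fib : X → Type v
  [addCommGroup : ∀ x, AddCommGroup (fib x)]
  [module : ∀ x, Module 𝕜 (fib x)]
  [topology : TopologicalSpace (TotalSpace Unit fib)]
  continuous_proj : Continuous (fun p : TotalSpace Unit fib => p.1)
  exists_trivialization : ∀ x₀ : X, ∃ U : Set X, IsOpen U ∧ x₀ ∈ U ∧ ∃ (n : ℕ)
    (φ : ∀ x, fib x →ₗ[𝕜] (Fin n → 𝕜)) (ψ : ∀ x, (Fin n → 𝕜) →ₗ[𝕜] fib x),
    (∀ x ∈ U, (∀ v, ψ x (φ x v) = v) ∧ ∀ w, φ x (ψ x w) = w) ∧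
    ContinuousOn (fun p : TotalSpace Unit fib => φ p.1 p.2) {p | p.1 ∈ U} ∧
    ContinuousOn (fun q : X × (Fin n → 𝕜) => (⟨q.1, ψ q.1 q.2⟩ : TotalSpace Unit fib))
      {q | q.1 ∈ U}

namespace FinVectorBundle

attribute [instance] addCommGroup module topology

variable {𝕜 : Type w} [RCLike 𝕜] {X : Type u} [TopologicalSpace X]

/-- Isomorphism of vector bundles over `X`: a homeomorphism of the total spaces over `X` which is
linear in each fibre. -/
def Isomorphic (A B : FinVectorBundle.{v} 𝕜 X) : Prop :=
  ∃ f : ∀ x, A.fib x ≃ₗ[𝕜] B.fib x,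
    Continuous (fun p : TotalSpace Unit A.fib => (⟨p.1, f p.1 p.2⟩ : TotalSpace Unit B.fib)) ∧
    Continuous (fun p : TotalSpace Unit B.fib => (⟨p.1, (f p.1).symm p.2⟩ : TotalSpace Unit A.fib))

theorem Isomorphic.refl (A : FinVectorBundle.{v} 𝕜 X) : Isomorphic A A :=
  ⟨fun _ => LinearEquiv.refl 𝕜 _, continuous_id, continuous_id⟩

theorem Isomorphic.symm {A B : FinVectorBundle.{v} 𝕜 X} (h : Isomorphic A B) : Isomorphic B A := by
  obtain ⟨f, h₁, h₂⟩ := h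
  exact ⟨fun x => (f x).symm, h₂, h₁⟩

theorem Isomorphic.trans {A B C : FinVectorBundle.{v} 𝕜 X} (h : Isomorphic A B)
    (h' : Isomorphic B C) : Isomorphic A C := by
  obtain ⟨f, h₁, h₂⟩ := h
  obtain ⟨g, h₃, h₄⟩ := h'
  exact ⟨fun x => (f x).trans (g x), h₃.comp h₁, h₂.comp h₄⟩

instance setoid : Setoid (FinVectorBundle.{v} 𝕜 X) where
  r := Isomorphic
  iseqv := ⟨Isomorphic.refl, Isomorphic.symm, Isomorphic.trans⟩

/-- The total space of the direct sum has the topology of the fibre product. -/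
instance sumTopology (A B : FinVectorBundle.{v} 𝕜 X) :
    TopologicalSpace (TotalSpace Unit (fun x => A.fib x × B.fib x)) :=
  TopologicalSpace.induced (fun p => ((⟨p.1, p.2.1⟩ : TotalSpace Unit A.fib),
    (⟨p.1, p.2.2⟩ : TotalSpace Unit B.fib))) inferInstance

theorem isInducing_sum (A B : FinVectorBundle.{v} 𝕜 X) :
    IsInducing (fun p : TotalSpace Unit (fun x => A.fib x × B.fib x) =>
      ((⟨p.1, p.2.1⟩ : TotalSpace Unit A.fib), (⟨p.1, p.2.2⟩ : TotalSpace Unit B.fib))) :=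
  ⟨rfl⟩

theorem continuous_fst (A B : FinVectorBundle.{v} 𝕜 X) :
    Continuous (fun p : TotalSpace Unit (fun x => A.fib x × B.fib x) =>
      (⟨p.1, p.2.1⟩ : TotalSpace Unit A.fib)) :=
  _root_.continuous_fst.comp (isInducing_sum A B).continuous

theorem continuous_snd (A B : FinVectorBundle.{v} 𝕜 X) :
    Continuous (fun p : TotalSpace Unit (fun x => A.fib x × B.fib x) =>
      (⟨p.1, p.2.2⟩ : TotalSpace Unit B.fib)) :=
  _root_.continuous_snd.comp (isInducing_sum A B).continuous

/-- The direct (Whitney) sum. -/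
def sum (A B : FinVectorBundle.{v} 𝕜 X) : FinVectorBundle.{v} 𝕜 X where
  fib x := A.fib x × B.fib x
  continuous_proj := A.continuous_proj.comp (continuous_fst A B)
  exists_trivialization x₀ := by
    obtain ⟨U, hU, hxU, n, φ, ψ, h, hφ, hψ⟩ := A.exists_trivialization x₀
    obtain ⟨U', hU', hxU', n', φ', ψ', h', hφ', hψ'⟩ := B.exists_trivialization x₀
    let e : ((Fin n → 𝕜) × (Fin n' → 𝕜)) ≃L[𝕜] (Fin (n + n') → 𝕜) :=
      ContinuousLinearEquiv.ofFinrankEq (by simp)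
    refine ⟨U ∩ U', hU.inter hU', ⟨hxU, hxU'⟩, n + n',
      fun x => e.toLinearEquiv.toLinearMap ∘ₗ (φ x).prodMap (φ' x),
      fun x => (ψ x).prodMap (ψ' x) ∘ₗ e.symm.toLinearEquiv.toLinearMap, ?_, ?_, ?_⟩
    · intro x hx
      refine ⟨fun v => ?_, fun w => ?_⟩
      · simp [(h x hx.1).1, (h' x hx.2).1]
      · simp [(h x hx.1).2, (h' x hx.2).2]
    · refine e.continuous.comp_continuousOn (ContinuousOn.prodMk ?_ ?_)
      · exact hφ.comp (continuous_fst A B).continuousOn fun p hp => hp.1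
      · exact hφ'.comp (continuous_snd A B).continuousOn fun p hp => hp.2
    · rw [(isInducing_sum A B).continuousOn_iff]
      refine ContinuousOn.prodMk ?_ ?_
      · exact hψ.comp (f := fun q : X × (Fin (n + n') → 𝕜) => (q.1, (e.symm q.2).1))
          (by fun_prop) fun p hp => hp.1
      · exact hψ'.comp (f := fun q : X × (Fin (n + n') → 𝕜) => (q.1, (e.symm q.2).2))
          (by fun_prop) fun p hp => hp.2

instance zeroTopology : TopologicalSpace (TotalSpace Unit (fun _ : X => PUnit.{v + 1})) :=
  TopologicalSpace.induced (fun p => p.1) inferInstance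

variable (𝕜 X) in
/-- The bundle of rank zero. -/
def zero : FinVectorBundle.{v} 𝕜 X where
  fib _ := PUnit
  continuous_proj := continuous_induced_dom
  exists_trivialization x₀ := by
    refine ⟨Set.univ, isOpen_univ, trivial, 0, fun _ => 0, fun _ => 0, ?_, ?_, ?_⟩
    · exact fun x _ => ⟨fun v => rfl, fun w => Subsingleton.elim _ _⟩
    · exact continuousOn_const
    · have h : Continuous (fun q : X × (Fin 0 → 𝕜) =>
          (⟨q.1, PUnit.unit⟩ : TotalSpace Unit (fun _ : X => PUnit.{v + 1}))) :=
        continuous_induced_rng.2 _root_.continuous_fst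
      exact h.continuousOn

theorem continuous_mk_sum {T : Type*} [TopologicalSpace T] {A B : FinVectorBundle.{v} 𝕜 X}
    {b : T → X} {f : ∀ t, A.fib (b t)} {g : ∀ t, B.fib (b t)}
    (hf : Continuous fun t => (⟨b t, f t⟩ : TotalSpace Unit A.fib))
    (hg : Continuous fun t => (⟨b t, g t⟩ : TotalSpace Unit B.fib)) :
    Continuous fun t => (⟨b t, (f t, g t)⟩ : TotalSpace Unit (sum A B).fib) :=
  continuous_induced_rng.2 (hf.prodMk hg)

theorem sum_congr {A B A' B' : FinVectorBundle.{v} 𝕜 X} (h : Isomorphic A A')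
    (h' : Isomorphic B B') : Isomorphic (sum A B) (sum A' B') := by
  obtain ⟨f, h₁, h₂⟩ := h
  obtain ⟨g, h₃, h₄⟩ := h'
  exact ⟨fun x => (f x).prodCongr (g x),
    continuous_mk_sum (h₁.comp (continuous_fst A B)) (h₃.comp (continuous_snd A B)),
    continuous_mk_sum (h₂.comp (continuous_fst A' B')) (h₄.comp (continuous_snd A' B'))⟩

theorem sum_comm (A B : FinVectorBundle.{v} 𝕜 X) : Isomorphic (sum A B) (sum B A) :=
  ⟨fun x => LinearEquiv.prodComm 𝕜 (A.fib x) (B.fib x),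
    continuous_mk_sum (continuous_snd A B) (continuous_fst A B),
    continuous_mk_sum (continuous_snd B A) (continuous_fst B A)⟩

theorem sum_assoc (A B C : FinVectorBundle.{v} 𝕜 X) :
    Isomorphic (sum (sum A B) C) (sum A (sum B C)) := by
  have h₁ := continuous_fst (sum A B) C
  have h₂ := continuous_snd (sum A B) C
  have h₃ := continuous_fst A (sum B C)
  have h₄ := continuous_snd A (sum B C)
  refine ⟨fun x => LinearEquiv.prodAssoc 𝕜 (A.fib x) (B.fib x) (C.fib x), ?_, ?_⟩
  · have h₅ : Continuous fun p : TotalSpace Unit (sum (sum A B) C).fib =>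
        (⟨p.1, (p.2.1.2, p.2.2)⟩ : TotalSpace Unit (sum B C).fib) :=
      continuous_mk_sum (f := fun p : TotalSpace Unit (sum (sum A B) C).fib => p.2.1.2)
        (g := fun p => p.2.2) ((continuous_snd A B).comp h₁) h₂
    exact continuous_mk_sum (f := fun p : TotalSpace Unit (sum (sum A B) C).fib => p.2.1.1)
      (B := sum B C) (g := fun p => (p.2.1.2, p.2.2)) ((continuous_fst A B).comp h₁) h₅
  · have h₅ : Continuous fun p : TotalSpace Unit (sum A (sum B C)).fib =>
        (⟨p.1, (p.2.1, p.2.2.1)⟩ : TotalSpace Unit (sum A B).fib) :=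
      continuous_mk_sum (f := fun p : TotalSpace Unit (sum A (sum B C)).fib => p.2.1)
        (g := fun p => p.2.2.1) h₃ ((continuous_fst B C).comp h₄)
    exact continuous_mk_sum (A := sum A B) (B := C)
      (f := fun p : TotalSpace Unit (sum A (sum B C)).fib => (p.2.1, p.2.2.1))
      (g := fun p => p.2.2.2) h₅ ((continuous_snd B C).comp h₄)

theorem zero_sum (A : FinVectorBundle.{v} 𝕜 X) : Isomorphic (sum (zero 𝕜 X) A) A :=
  ⟨fun _ => { toFun := fun p => p.2
              invFun := fun v => (PUnit.unit, v)
              map_add' := fun _ _ => rfl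
              map_smul' := fun _ _ => rfl
              left_inv := fun _ => rfl
              right_inv := fun _ => rfl },
    continuous_snd (zero 𝕜 X) A,
    continuous_mk_sum (A := zero 𝕜 X) (continuous_induced_rng.2 A.continuous_proj) continuous_id⟩

variable (𝕜 X) in
/-- The isomorphism classes of finite dimensional vector bundles over `X`. -/
def Classes := Quotient (setoid (𝕜 := 𝕜) (X := X) : Setoid (FinVectorBundle.{v} 𝕜 X))

instance : Add (Classes.{v} 𝕜 X) := ⟨Quotient.map₂ sum fun _ _ h _ _ h' => sum_congr h h'⟩

instance : Zero (Classes.{v} 𝕜 X) := ⟨Quotient.mk _ (zero 𝕜 X)⟩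

/-- Isomorphism classes form a commutative monoid under the direct sum. -/
instance : AddCommMonoid (Classes.{v} 𝕜 X) where
  add_assoc := by
    rintro ⟨A⟩ ⟨B⟩ ⟨C⟩
    exact Quotient.sound (sum_assoc A B C)
  zero_add := by
    rintro ⟨A⟩
    exact Quotient.sound (zero_sum A)
  add_zero := by
    rintro ⟨A⟩
    exact Quotient.sound ((sum_comm A _).trans (zero_sum A))
  add_comm := by
    rintro ⟨A⟩ ⟨B⟩
    exact Quotient.sound (sum_comm A B)
  nsmul := nsmulRec

/-- A Mathlib vector bundle whose model fibre `F` is finite dimensional, as a finite dimensional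
vector bundle: the fibres and the topology of the total space are the given ones. -/
def ofVectorBundle {F : Type*} [NormedAddCommGroup F] [NormedSpace 𝕜 F] (hF : FiniteDimensional 𝕜 F)
    (E : X → Type v) [∀ x, AddCommGroup (E x)] [∀ x, Module 𝕜 (E x)] [∀ x, TopologicalSpace (E x)]
    [TopologicalSpace (TotalSpace F E)] [FiberBundle F E] [VectorBundle 𝕜 F E] :
    FinVectorBundle.{v} 𝕜 X where
  fib := E
  topology := TopologicalSpace.induced
    (fun p : TotalSpace Unit E => (⟨p.1, p.2⟩ : TotalSpace F E)) inferInstance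
  continuous_proj := by
    let _ : TopologicalSpace (TotalSpace Unit E) := TopologicalSpace.induced
      (fun p : TotalSpace Unit E => (⟨p.1, p.2⟩ : TotalSpace F E)) inferInstance
    have hι : IsInducing (fun p : TotalSpace Unit E => (⟨p.1, p.2⟩ : TotalSpace F E)) := ⟨rfl⟩
    exact (FiberBundle.continuous_proj F E).comp hι.continuous
  exists_trivialization x₀ := by
    let _ : TopologicalSpace (TotalSpace Unit E) := TopologicalSpace.induced
      (fun p : TotalSpace Unit E => (⟨p.1, p.2⟩ : TotalSpace F E)) inferInstance
    have hι : IsInducing (fun p : TotalSpace Unit E => (⟨p.1, p.2⟩ : TotalSpace F E)) := ⟨rfl⟩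
    let e := trivializationAt F E x₀
    let c : F ≃L[𝕜] (Fin (Module.finrank 𝕜 F) → 𝕜) :=
      ContinuousLinearEquiv.ofFinrankEq (by simp)
    refine ⟨e.baseSet, e.open_baseSet, FiberBundle.mem_baseSet_trivializationAt F E x₀,
      Module.finrank 𝕜 F, fun x => c.toLinearEquiv.toLinearMap ∘ₗ e.linearMapAt 𝕜 x,
      fun x => e.symmₗ 𝕜 x ∘ₗ c.symm.toLinearEquiv.toLinearMap, ?_, ?_, ?_⟩
    · intro x hx
      refine ⟨fun v => ?_, fun w => ?_⟩
      · simp [e.symmₗ_linearMapAt hx]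
      · simp [e.linearMapAt_symmₗ hx]
    · refine c.continuous.comp_continuousOn ?_
      have h : ContinuousOn (fun p : TotalSpace Unit E => (e ⟨p.1, p.2⟩).2) {p | p.1 ∈ e.baseSet} :=
        _root_.continuous_snd.comp_continuousOn (e.continuousOn.comp hι.continuous.continuousOn
          fun p hp => e.mem_source.2 hp)
      refine h.congr fun p hp => ?_
      rw [e.coe_linearMapAt_of_mem hp]
    · rw [hι.continuousOn_iff]
      have h : ContinuousOn (fun q : X × (Fin (Module.finrank 𝕜 F) → 𝕜) =>
          e.toOpenPartialHomeomorph.symm (q.1, c.symm q.2)) {q | q.1 ∈ e.baseSet} :=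
        e.toOpenPartialHomeomorph.continuousOn_symm.comp (f := fun q : X × (Fin (Module.finrank 𝕜 F) → 𝕜) =>
          (q.1, c.symm q.2)) (by fun_prop) fun q hq => e.mem_target.2 hq
      refine h.congr fun q hq => ?_
      simp [e.symmₗ_apply hq, e.mk_symm hq]

end FinVectorBundle

/-- `K(X)` (that is, `KO(X)` if `𝕜 = ℝ`): the Grothendieck group of the monoid of isomorphism
classes of finite dimensional `𝕜`-vector bundles over `X`. -/
abbrev KGroup (𝕜 : Type w) [RCLike 𝕜] (X : Type u) [TopologicalSpace X] :=
  Algebra.GrothendieckAddGroup (FinVectorBundle.Classes.{v} 𝕜 X)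

/-- The class `[A] ∈ K(X)` of a finite dimensional vector bundle `A` over `X`. -/
def KGroup.cls {𝕜 : Type w} [RCLike 𝕜] {X : Type u} [TopologicalSpace X]
    (A : FinVectorBundle.{v} 𝕜 X) : KGroup.{v} 𝕜 X :=
  Algebra.GrothendieckAddGroup.of (Quotient.mk _ A : FinVectorBundle.Classes.{v} 𝕜 X)

/-! ### Subbundles of Banach bundles -/

section Banach

variable {𝕜 : Type w} [RCLike 𝕜] {X : Type u} [TopologicalSpace X]

/-- A subbundle of a Banach bundle `E` with model fibre `F`: a family of subspaces of the fibres for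
which there is a Banach space (the model fibre, realized as a closed subspace of `F`) and around
each point of `X` a local trivialization `E|U ≅ U × F` of the Banach bundle `E` carrying the
subspaces over `U` to a constant closed subspace `V₀` of `F` isomorphic to the model fibre.
Here the local trivialization is a local trivialization belonging to the atlas of `E`, followed by
a norm continuous family `T` of automorphisms of `F`. -/
structure Subbundle (𝕜 : Type w) [RCLike 𝕜] {X : Type u} [TopologicalSpace X]
    (F : Type*) [NormedAddCommGroup F] [NormedSpace 𝕜 F]
    (E : X → Type v) [∀ x, AddCommGroup (E x)] [∀ x, Module 𝕜 (E x)] [∀ x, TopologicalSpace (E x)]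
    [TopologicalSpace (TotalSpace F E)] [FiberBundle F E] [VectorBundle 𝕜 F E] where
  /-- the fibres, as subspaces of the fibres of `E` -/
  carrier : ∀ x, Submodule 𝕜 (E x)
  /-- the model fibre -/
  model : Submodule 𝕜 F
  isClosed_model : IsClosed (model : Set F)
  exists_adapted : ∀ x₀ : X, ∃ V₀ : Submodule 𝕜 F, IsClosed (V₀ : Set F) ∧
    Nonempty (model ≃L[𝕜] V₀) ∧
    ∃ U : Set X, IsOpen U ∧ x₀ ∈ U ∧ U ⊆ (trivializationAt F E x₀).baseSet ∧
    ∃ T : X → (F ≃L[𝕜] F), ContinuousOn (fun x => (T x : F →L[𝕜] F)) U ∧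
      ∀ x ∈ U, ∀ v : E x,
        v ∈ carrier x ↔ T x ((trivializationAt F E x₀).continuousLinearMapAt 𝕜 x v) ∈ V₀

namespace Subbundle

variable {F : Type*} [NormedAddCommGroup F] [NormedSpace 𝕜 F]
  {E : X → Type v} [∀ x, AddCommGroup (E x)] [∀ x, Module 𝕜 (E x)] [∀ x, TopologicalSpace (E x)]
  [TopologicalSpace (TotalSpace F E)] [FiberBundle F E] [VectorBundle 𝕜 F E]
  (S : Subbundle 𝕜 F E)

/-- A subbundle is direct if each of its fibres is complemented: it is the image of a continuous
projection. -/
def IsDirect : Prop := ∀ x, (S.carrier x).ClosedComplemented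

/-- The fibres of a subbundle, with the structure induced by the fibres of the ambient bundle. -/
def Fiber (x : X) : Type v := S.carrier x

instance (x : X) : AddCommGroup (S.Fiber x) := inferInstanceAs (AddCommGroup (S.carrier x))
instance (x : X) : Module 𝕜 (S.Fiber x) := inferInstanceAs (Module 𝕜 (S.carrier x))
instance (x : X) : TopologicalSpace (S.Fiber x) := inferInstanceAs (TopologicalSpace (S.carrier x))
instance (x : X) [IsTopologicalAddGroup (E x)] : IsTopologicalAddGroup (S.Fiber x) :=
  inferInstanceAs (IsTopologicalAddGroup (S.carrier x))
instance (x : X) [ContinuousSMul 𝕜 (E x)] : ContinuousSMul 𝕜 (S.Fiber x) :=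
  inferInstanceAs (ContinuousSMul 𝕜 (S.carrier x))

/-- The inclusion of a fibre of the subbundle. -/
def incl (x : X) : S.Fiber x →L[𝕜] E x := (S.carrier x).subtypeL

theorem incl_injective (x : X) : Function.Injective (S.incl x) := Subtype.val_injective

theorem incl_mem {x : X} (v : S.Fiber x) : S.incl x v ∈ S.carrier x := Subtype.prop v

instance completeSpace_model [CompleteSpace F] : CompleteSpace S.model :=
  S.isClosed_model.completeSpace_coe

/-! Chosen adapted trivializations, which make a subbundle a Banach bundle. -/

/-- The constant fibre of the chosen adapted trivialization around `x₀`. -/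
def locModel (x₀ : X) : Submodule 𝕜 F := (S.exists_adapted x₀).choose

/-- Its identification with the model fibre. -/
def locEquiv (x₀ : X) : S.model ≃L[𝕜] S.locModel x₀ := (S.exists_adapted x₀).choose_spec.2.1.some

/-- The domain of the chosen adapted trivialization around `x₀`. -/
def dom (x₀ : X) : Set X := (S.exists_adapted x₀).choose_spec.2.2.choose

theorem isOpen_dom (x₀ : X) : IsOpen (S.dom x₀) :=
  (S.exists_adapted x₀).choose_spec.2.2.choose_spec.1

theorem mem_dom (x₀ : X) : x₀ ∈ S.dom x₀ :=
  (S.exists_adapted x₀).choose_spec.2.2.choose_spec.2.1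

theorem dom_subset (x₀ : X) : S.dom x₀ ⊆ (trivializationAt F E x₀).baseSet :=
  (S.exists_adapted x₀).choose_spec.2.2.choose_spec.2.2.1

/-- The automorphisms of `F` straightening the subbundle around `x₀`. -/
def straight (x₀ : X) : X → (F ≃L[𝕜] F) :=
  (S.exists_adapted x₀).choose_spec.2.2.choose_spec.2.2.2.choose

theorem continuousOn_straight (x₀ : X) :
    ContinuousOn (fun x => (S.straight x₀ x : F →L[𝕜] F)) (S.dom x₀) :=
  (S.exists_adapted x₀).choose_spec.2.2.choose_spec.2.2.2.choose_spec.1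

theorem mem_carrier_iff (x₀ : X) {x : X} (hx : x ∈ S.dom x₀) (v : E x) : v ∈ S.carrier x ↔
    S.straight x₀ x ((trivializationAt F E x₀).continuousLinearMapAt 𝕜 x v) ∈ S.locModel x₀ :=
  (S.exists_adapted x₀).choose_spec.2.2.choose_spec.2.2.2.choose_spec.2 x hx v

/-- The chosen adapted trivialization around `x₀`, on the fibre over `x`. -/
def toModel (x₀ : X) {x : X} (hx : x ∈ S.dom x₀) : S.Fiber x →L[𝕜] S.model :=
  (S.locEquiv x₀).symm.toContinuousLinearMap ∘L
    ((S.straight x₀ x).toContinuousLinearMap ∘L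
      (trivializationAt F E x₀).continuousLinearMapAt 𝕜 x ∘L S.incl x).codRestrict (S.locModel x₀)
      fun v => (S.mem_carrier_iff x₀ hx _).1 (S.incl_mem v)

/-- The inverse of `toModel`, as a map to the fibre of the ambient bundle. -/
def fromModelAux (x₀ x : X) : S.model →L[𝕜] E x :=
  (trivializationAt F E x₀).symmL 𝕜 x ∘L (S.straight x₀ x).symm.toContinuousLinearMap ∘L
    (S.locModel x₀).subtypeL ∘L (S.locEquiv x₀).toContinuousLinearMap

theorem fromModelAux_mem (x₀ : X) {x : X} (hx : x ∈ S.dom x₀) (w : S.model) :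
    S.fromModelAux x₀ x w ∈ S.carrier x := by
  rw [S.mem_carrier_iff x₀ hx]
  simp [fromModelAux, -Trivialization.continuousLinearMapAt_apply,
    (trivializationAt F E x₀).continuousLinearMapAt_symmL (S.dom_subset x₀ hx)]

/-- The inverse of `toModel`. -/
def fromModel (x₀ : X) {x : X} (hx : x ∈ S.dom x₀) : S.model →L[𝕜] S.Fiber x :=
  (S.fromModelAux x₀ x).codRestrict (S.carrier x) (S.fromModelAux_mem x₀ hx)

theorem incl_fromModel (x₀ : X) {x : X} (hx : x ∈ S.dom x₀) (w : S.model) :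
    S.incl x (S.fromModel x₀ hx w) = S.fromModelAux x₀ x w := rfl

theorem coe_locEquiv_toModel (x₀ : X) {x : X} (hx : x ∈ S.dom x₀) (v : S.Fiber x) :
    (S.locEquiv x₀ (S.toModel x₀ hx v) : F) =
      S.straight x₀ x ((trivializationAt F E x₀).continuousLinearMapAt 𝕜 x (S.incl x v)) := by
  rw [toModel, ContinuousLinearMap.comp_apply, ContinuousLinearEquiv.coe_coe,
    ContinuousLinearEquiv.apply_symm_apply]
  rfl

theorem toModel_fromModel (x₀ : X) {x : X} (hx : x ∈ S.dom x₀) (w : S.model) :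
    S.toModel x₀ hx (S.fromModel x₀ hx w) = w := by
  apply (S.locEquiv x₀).injective
  apply Subtype.ext
  rw [coe_locEquiv_toModel, incl_fromModel]
  simp [fromModelAux, -Trivialization.continuousLinearMapAt_apply,
    (trivializationAt F E x₀).continuousLinearMapAt_symmL (S.dom_subset x₀ hx)]

theorem fromModel_toModel (x₀ : X) {x : X} (hx : x ∈ S.dom x₀) (v : S.Fiber x) :
    S.fromModel x₀ hx (S.toModel x₀ hx v) = v := by
  apply S.incl_injective
  rw [incl_fromModel]
  simp [fromModelAux, coe_locEquiv_toModel, -Trivialization.continuousLinearMapAt_apply,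
    -Trivialization.symmL_apply,
    (trivializationAt F E x₀).symmL_continuousLinearMapAt (S.dom_subset x₀ hx)]

open scoped Classical in
/-- The chosen adapted trivialization around `x₀`. -/
def pretriv (x₀ : X) : Pretrivialization S.model (π S.model S.Fiber) where
  toFun p := (p.1, if h : p.1 ∈ S.dom x₀ then S.toModel x₀ h p.2 else 0)
  invFun q := ⟨q.1, if h : q.1 ∈ S.dom x₀ then S.fromModel x₀ h q.2 else 0⟩
  source := TotalSpace.proj ⁻¹' S.dom x₀
  target := S.dom x₀ ×ˢ Set.univ
  map_source' p hp := ⟨hp, trivial⟩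
  map_target' q hq := hq.1
  left_inv' := by
    rintro ⟨x, v⟩ (hx : x ∈ S.dom x₀)
    simp [hx, fromModel_toModel]
  right_inv' := by
    rintro ⟨x, w⟩ ⟨hx : x ∈ S.dom x₀, -⟩
    simp [hx, toModel_fromModel]
  open_target := (S.isOpen_dom x₀).prod isOpen_univ
  baseSet := S.dom x₀
  open_baseSet := S.isOpen_dom x₀
  source_eq := rfl
  target_eq := rfl
  proj_toFun _ _ := rfl

theorem pretriv_apply (x₀ : X) {x : X} (hx : x ∈ S.dom x₀) (v : S.Fiber x) :
    S.pretriv x₀ ⟨x, v⟩ = (x, S.toModel x₀ hx v) := by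
  change (x, _) = _
  simp [hx]

theorem pretriv_symm (x₀ : X) {x : X} (hx : x ∈ S.dom x₀) (w : S.model) :
    (S.pretriv x₀).symm x w = S.fromModel x₀ hx w := by
  have h := (S.pretriv x₀).symm_apply_apply_mk (b := x) hx (S.fromModel x₀ hx w)
  rwa [S.pretriv_apply x₀ hx, toModel_fromModel] at h

/-- A family of operators into a subspace is norm continuous if it is so as a family of operators
into the whole space. -/
theorem continuousOn_of_subtypeL {Y G : Type*} [TopologicalSpace Y] [NormedAddCommGroup G]
    [NormedSpace 𝕜 G] {V : Submodule 𝕜 F} {g : Y → (G →L[𝕜] V)} {s : Set Y}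
    (h : ContinuousOn (fun y => V.subtypeL ∘L g y) s) : ContinuousOn g s :=
  ((V.subtypeₗᵢ.postcomp (σ₁₂ := RingHom.id 𝕜) (E := G)).isometry.isEmbedding.isInducing.continuousOn_iff).2 h

theorem continuousOn_straight_symm [CompleteSpace F] (x₀ : X) :
    ContinuousOn (fun x => ((S.straight x₀ x).symm : F →L[𝕜] F)) (S.dom x₀) := by
  intro x hx
  have h : ContinuousAt (ContinuousLinearMap.inverse : (F →L[𝕜] F) → (F →L[𝕜] F))
      (S.straight x₀ x : F →L[𝕜] F) :=
    (contDiffAt_map_inverse (𝕜 := 𝕜) (n := 0) (S.straight x₀ x)).continuousAt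
  have h' := h.comp_continuousWithinAt (f := fun x => (S.straight x₀ x : F →L[𝕜] F)) (S.continuousOn_straight x₀ x hx)
  simpa [Function.comp_def] using h'

/-- The coordinate change between two of the chosen trivializations. -/
theorem exists_coordChange [CompleteSpace F] (x₀ x₁ : X) :
    ∃ f : X → S.model →L[𝕜] S.model, ContinuousOn f (S.dom x₀ ∩ S.dom x₁) ∧
      ∀ x (h₀ : x ∈ S.dom x₀) (h₁ : x ∈ S.dom x₁) (w : S.model),
        f x w = S.toModel x₁ h₁ (S.fromModel x₀ h₀ w) := by
  classical
  let f : X → S.model →L[𝕜] S.model := fun x =>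
    if h : x ∈ S.dom x₀ ∩ S.dom x₁ then S.toModel x₁ h.2 ∘L S.fromModel x₀ h.1 else 0
  have hf : ∀ x (h₀ : x ∈ S.dom x₀) (h₁ : x ∈ S.dom x₁) (w : S.model),
      f x w = S.toModel x₁ h₁ (S.fromModel x₀ h₀ w) := by
    intro x h₀ h₁ w
    have h : x ∈ S.dom x₀ ∩ S.dom x₁ := ⟨h₀, h₁⟩
    simp only [f, dif_pos h]
    rfl
  refine ⟨f, ?_, hf⟩
  have key : ContinuousOn (fun x => (S.locEquiv x₁).toContinuousLinearMap ∘L f x)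
      (S.dom x₀ ∩ S.dom x₁) := by
    apply continuousOn_of_subtypeL
    have hc : ContinuousOn (fun x => (Trivialization.coordChangeL 𝕜 (trivializationAt F E x₀)
        (trivializationAt F E x₁) x : F →L[𝕜] F)) (S.dom x₀ ∩ S.dom x₁) :=
      (continuousOn_coordChange 𝕜 (trivializationAt F E x₀) (trivializationAt F E x₁)).mono
        (Set.inter_subset_inter (S.dom_subset x₀) (S.dom_subset x₁))
    have h₁ := (((S.continuousOn_straight x₁).mono Set.inter_subset_right).clm_comp
      (hc.clm_comp ((S.continuousOn_straight_symm x₀).mono Set.inter_subset_left))).clm_comp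
      (continuousOn_const (c := (S.locModel x₀).subtypeL ∘L
        (S.locEquiv x₀).toContinuousLinearMap))
    refine h₁.congr fun x hx => ?_
    ext w
    have hb : x ∈ (trivializationAt F E x₀).baseSet ∩ (trivializationAt F E x₁).baseSet :=
      ⟨S.dom_subset x₀ hx.1, S.dom_subset x₁ hx.2⟩
    simp [hf x hx.1 hx.2, coe_locEquiv_toModel, incl_fromModel, fromModelAux,
      Trivialization.coordChangeL_apply _ _ hb, hb.1, hb.2]
  have := (continuousOn_const (c := (S.locEquiv x₁).symm.toContinuousLinearMap)).clm_comp key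
  refine this.congr fun x hx => ?_
  ext w
  simp

/-- The adapted trivializations form an atlas with norm continuous coordinate changes. -/
def vectorPrebundle [CompleteSpace F] : VectorPrebundle 𝕜 S.model S.Fiber where
  pretrivializationAtlas := Set.range S.pretriv
  pretrivialization_linear' := by
    rintro _ ⟨x₀, rfl⟩
    refine ⟨fun x (hx : x ∈ S.dom x₀) => ?_⟩
    simp only [S.pretriv_apply x₀ hx]
    exact (S.toModel x₀ hx).toLinearMap.isLinear
  pretrivializationAt := S.pretriv
  mem_base_pretrivializationAt := S.mem_dom
  pretrivialization_mem_atlas x := ⟨x, rfl⟩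
  exists_coordChange := by
    rintro _ ⟨x₀, rfl⟩ _ ⟨x₁, rfl⟩
    obtain ⟨f, hf, hf'⟩ := S.exists_coordChange x₀ x₁
    refine ⟨f, hf, fun x hx w => ?_⟩
    rw [hf' x hx.1 hx.2, S.pretriv_symm x₀ hx.1, S.pretriv_apply x₁ hx.2]
  totalSpaceMk_isInducing x := by
    have h : (S.pretriv x ∘ TotalSpace.mk x) = fun v => (x, S.toModel x (S.mem_dom x) v) :=
      funext fun v => S.pretriv_apply x (S.mem_dom x) v
    rw [h, isInducing_const_prod]
    exact (ContinuousLinearEquiv.equivOfInverse (S.toModel x (S.mem_dom x))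
      (S.fromModel x (S.mem_dom x)) (S.fromModel_toModel x (S.mem_dom x))
      (S.toModel_fromModel x (S.mem_dom x))).toHomeomorph.isInducing

/-! A subbundle of a Banach bundle is a Banach bundle. -/

instance [CompleteSpace F] : TopologicalSpace (TotalSpace S.model S.Fiber) :=
  S.vectorPrebundle.totalSpaceTopology

instance [CompleteSpace F] : FiberBundle S.model S.Fiber := S.vectorPrebundle.toFiberBundle

instance [CompleteSpace F] : VectorBundle 𝕜 S.model S.Fiber := S.vectorPrebundle.toVectorBundle

/-- The class in `K(X)` of a finite dimensional subbundle of a Banach bundle. -/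
def kClass [CompleteSpace F] (h : FiniteDimensional 𝕜 S.model) : KGroup.{v} 𝕜 X :=
  KGroup.cls (FinVectorBundle.ofVectorBundle h S.Fiber)

end Subbundle

/-! ### Fredholm morphisms and the index bundle -/

/-- A morphism `E₁ → E₂` of Banach bundles: a family of bounded operators between the fibres that is
continuous with respect to the operator norm in local trivializations, that is, a continuous section
of the bundle of bounded operators. -/
structure BanachMorphism (𝕜 : Type w) [RCLike 𝕜] {X : Type u} [TopologicalSpace X]
    (F₁ : Type*) [NormedAddCommGroup F₁] [NormedSpace 𝕜 F₁]
    (E₁ : X → Type v) [∀ x, AddCommGroup (E₁ x)] [∀ x, Module 𝕜 (E₁ x)]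
    [∀ x, TopologicalSpace (E₁ x)]
    [TopologicalSpace (TotalSpace F₁ E₁)] [FiberBundle F₁ E₁] [VectorBundle 𝕜 F₁ E₁]
    (F₂ : Type*) [NormedAddCommGroup F₂] [NormedSpace 𝕜 F₂]
    (E₂ : X → Type v) [∀ x, AddCommGroup (E₂ x)] [∀ x, Module 𝕜 (E₂ x)]
    [∀ x, TopologicalSpace (E₂ x)]
    [∀ x, IsTopologicalAddGroup (E₂ x)] [∀ x, ContinuousSMul 𝕜 (E₂ x)]
    [TopologicalSpace (TotalSpace F₂ E₂)] [FiberBundle F₂ E₂] [VectorBundle 𝕜 F₂ E₂] where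
  /-- the operators between the fibres -/
  toFun : ∀ x, E₁ x →L[𝕜] E₂ x
  continuous_toFun : Continuous fun x =>
    (TotalSpace.mk' (F₁ →L[𝕜] F₂) x (toFun x) :
      TotalSpace (F₁ →L[𝕜] F₂) (fun x => E₁ x →L[𝕜] E₂ x))

/-- The index of a Fredholm operator. -/
def fredholmIndex {𝕜 : Type*} [RCLike 𝕜] {G H : Type*} [AddCommGroup G] [Module 𝕜 G]
    [TopologicalSpace G] [AddCommGroup H] [Module 𝕜 H] [TopologicalSpace H] (A : G →L[𝕜] H) : ℤ :=
  (Module.finrank 𝕜 A.ker : ℤ) - (Module.finrank 𝕜 (H ⧸ A.range) : ℤ)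

namespace BanachMorphism

variable
  {F₁ : Type*} [NormedAddCommGroup F₁] [NormedSpace 𝕜 F₁]
  {E₁ : X → Type v} [∀ x, AddCommGroup (E₁ x)] [∀ x, Module 𝕜 (E₁ x)]
  [∀ x, TopologicalSpace (E₁ x)]
  [TopologicalSpace (TotalSpace F₁ E₁)] [FiberBundle F₁ E₁] [VectorBundle 𝕜 F₁ E₁]
  {F₂ : Type*} [NormedAddCommGroup F₂] [NormedSpace 𝕜 F₂]
  {E₂ : X → Type v} [∀ x, AddCommGroup (E₂ x)] [∀ x, Module 𝕜 (E₂ x)]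
  [∀ x, TopologicalSpace (E₂ x)]
  [∀ x, IsTopologicalAddGroup (E₂ x)] [∀ x, ContinuousSMul 𝕜 (E₂ x)]
  [TopologicalSpace (TotalSpace F₂ E₂)] [FiberBundle F₂ E₂] [VectorBundle 𝕜 F₂ E₂]
  (L : BanachMorphism 𝕜 F₁ E₁ F₂ E₂)

/-- `L` is a Fredholm morphism of index `k`: a Fredholm operator of index `k` in each fibre. -/
def IsFredholmOfIndex (k : ℤ) : Prop := ∀ x, (L.toFun x).IsFredholm ∧ fredholmIndex (L.toFun x) = k

/-- `L` is a Fredholm morphism: it is a Fredholm morphism of index `k` for some `k`. -/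
def IsFredholm : Prop := ∃ k : ℤ, L.IsFredholmOfIndex k

/-- `V` is transversal to the image of `L`. -/
def Transversal (V : Subbundle 𝕜 F₂ E₂) : Prop := ∀ x, (L.toFun x).range ⊔ V.carrier x = ⊤

/-- The fibres of `E(L, V)`. -/
def preimage (V : Subbundle 𝕜 F₂ E₂) (x : X) : Submodule 𝕜 (E₁ x) :=
  (V.carrier x).comap (L.toFun x).toLinearMap

/-- `κ ∈ K(X)` is the index bundle of `L`: there are finite dimensional subbundles `W` transversal
to the image of `L`, and for any of them the spaces `L_x⁻¹(W_x)` form a finite dimensional subbundle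
`E(L, W)`, and `κ = [E(L, W)] - [W]`. -/
def HasIndexBundle [CompleteSpace F₁] [CompleteSpace F₂] (κ : KGroup.{v} 𝕜 X) : Prop :=
  (∃ W : Subbundle 𝕜 F₂ E₂, FiniteDimensional 𝕜 W.model ∧ L.Transversal W) ∧
  ∀ (W : Subbundle 𝕜 F₂ E₂) (hW : FiniteDimensional 𝕜 W.model), L.Transversal W →
    ∃ (D : Subbundle 𝕜 F₁ E₁) (hD : FiniteDimensional 𝕜 D.model),
      (∀ x, D.carrier x = L.preimage W x) ∧ κ = D.kClass hD - W.kClass hW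

open scoped Classical in
/-- The index bundle `ind L ∈ K(X)` of a Fredholm morphism over a compact base; by convention zero
if the index bundle is not defined. -/
def indexBundle [CompleteSpace F₁] [CompleteSpace F₂] : KGroup.{v} 𝕜 X :=
  if h : ∃ κ, L.HasIndexBundle κ then h.choose else 0

end BanachMorphism

end Banach

end

noncomputable section

set_option linter.unusedSectionVars false

/-! ### Operators between Banach spaces -/

section Operators

variable {𝕜 : Type*} [RCLike 𝕜]

/-! Near a point, straighten `V` to a constant closed subspace `V₀` and compose `L` with the
quotient map to get operators `A x : F₁ → F₂ ⧸ V₀` with kernel `L⁻¹(V)`. Transversality makes `A x₀`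
surjective. Its kernel is complemented, so `A x₀` has a right inverse `R`, and the automorphisms `1
+ R (A x - A x₀)` carry the kernels to a constant one (`exists_straighten`). One model fibre must
serve all points although `X` may be disconnected. The restrictions `L⁻¹(V) → V` are Fredholm
operators of the common index `k` into isomorphic spaces, so their sources are isomorphic after
adding finite dimensional summands, and these can be cancelled (`nonempty_equiv_of_isFredholm`).

The existence and independence statements behind the index bundle are proved as well. For existence
(`exists_transversal`), vectors that span the cokernel at one point supplement the image nearby, but
sections extending them may become dependent, so that their span is not a bundle. In an infinite
dimensional bundle this is repaired by general position: by Baire's theorem a section can be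
perturbed off a given finite dimensional subbundle `W` (`exists_section_notMem`), and then `W` plus
the line it spans is again a subbundle. Small perturbations do no harm because surjectivity is an
open condition. For independence (`kClass_add_kClass`), right inverses of `L` modulo `W` and modulo
`W'`, glued by partitions of unity, give an explicit isomorphism `E(L, W) ⊕ W' ≅ E(L, W') ⊕ W`.

The equality of indices then takes one subbundle. If a finite dimensional `W ⊂ V` is transversal to
the image of the restriction, it is transversal to the image of `L` inside the whole bundle, and
`L⁻¹(W)` already lies in `L⁻¹(V)`. Both index bundles are therefore the same difference of classes
(`indexBundle_restrictPreimage`). -/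

/-- A surjective operator between Banach spaces with complemented kernel has a right inverse. -/
theorem ContinuousLinearMap.exists_rightInverse_of_closedComplemented_ker {F G : Type*}
    [NormedAddCommGroup F] [NormedSpace 𝕜 F] [CompleteSpace F]
    [NormedAddCommGroup G] [NormedSpace 𝕜 G] [CompleteSpace G] (A : F →L[𝕜] G)
    (hA : Function.Surjective A) (hker : A.ker.ClosedComplemented) :
    ∃ R : G →L[𝕜] F, ∀ g, A (R g) = g := by
  obtain ⟨K, hK⟩ := hker.exists_isTopCompl
  have hKc : IsClosed (K : Set F) := hK.isClosed'
  have := hKc.completeSpace_coe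
  -- On a closed complement of the kernel, `A` is bijective; the open mapping theorem makes the
  -- inverse bounded.
  let B : K →L[𝕜] G := A ∘L K.subtypeL
  have hinj : B.ker = ⊥ := by
    refine (Submodule.eq_bot_iff _).2 fun k hk => Subtype.ext ?_
    have h : (k : F) ∈ A.ker ⊓ K := ⟨hk, k.2⟩
    rw [hK.isCompl.inf_eq_bot] at h
    exact h
  have hsurj : B.range = ⊤ := by
    refine LinearMap.range_eq_top.2 fun g => ?_
    obtain ⟨f, rfl⟩ := hA g
    obtain ⟨a, ha, k, hk, rfl⟩ := Submodule.mem_sup.1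
      (show f ∈ A.ker ⊔ K from hK.isCompl.sup_eq_top ▸ Submodule.mem_top)
    have ha' : A a = 0 := ha
    exact ⟨⟨k, hk⟩, by simp [B, ha']⟩
  let e := ContinuousLinearEquiv.ofBijective B hinj hsurj
  refine ⟨K.subtypeL ∘L e.symm.toContinuousLinearMap, fun g => ?_⟩
  exact ContinuousLinearEquiv.ofBijective_apply_symm_apply B hinj hsurj g

/-- A norm continuous family of operators which is the identity at a point consists of
isomorphisms near that point, and the inverses are norm continuous as well. -/
theorem exists_continuousLinearEquiv_of_eq_id {F : Type*} [NormedAddCommGroup F]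
    [NormedSpace 𝕜 F] [CompleteSpace F] {X : Type*} [TopologicalSpace X] {f : X → (F →L[𝕜] F)}
    {U : Set X} (hU : IsOpen U) (hf : ContinuousOn f U) {x₀ : X} (hx₀ : x₀ ∈ U)
    (h₁ : f x₀ = ContinuousLinearMap.id 𝕜 F) :
    ∃ U' ⊆ U, IsOpen U' ∧ x₀ ∈ U' ∧ ∃ T : X → (F ≃L[𝕜] F),
      (∀ x ∈ U', (T x : F →L[𝕜] F) = f x) ∧
      ContinuousOn (fun x => (T x : F →L[𝕜] F)) U' ∧
      ContinuousOn (fun x => ((T x).symm : F →L[𝕜] F)) U' := by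
  classical
  -- Where `f x` is not invertible the identity is a default value. Such points are outside the
  -- final neighbourhood, which is open because the units of a Banach algebra form an open set.
  let T : X → (F ≃L[𝕜] F) := fun x =>
    if h : IsUnit (f x) then ContinuousLinearEquiv.unitsEquiv 𝕜 F h.unit else .refl 𝕜 F
  have hT : ∀ x, IsUnit (f x) → (T x : F →L[𝕜] F) = f x := by
    intro x hx
    ext v
    simp [T, hx]
  have hU' : U ∩ f ⁻¹' {A | IsUnit A} ⊆ U := Set.inter_subset_left
  have hTc : ContinuousOn (fun x => (T x : F →L[𝕜] F)) (U ∩ f ⁻¹' {A | IsUnit A}) :=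
    (hf.mono hU').congr fun x hx => hT x hx.2
  refine ⟨U ∩ f ⁻¹' {A | IsUnit A}, hU', hf.isOpen_inter_preimage hU Units.isOpen,
    ⟨hx₀, ?_⟩, T, fun x hx => hT x hx.2, hTc, ?_⟩
  · change IsUnit (f x₀)
    rw [h₁]
    exact isUnit_one
  · intro x hx
    have h : ContinuousAt (ContinuousLinearMap.inverse : (F →L[𝕜] F) → (F →L[𝕜] F))
        (T x : F →L[𝕜] F) :=
      (contDiffAt_map_inverse (𝕜 := 𝕜) (n := 0) (T x)).continuousAt
    have h' := h.comp_continuousWithinAt (f := fun x => (T x : F →L[𝕜] F)) (hTc x hx)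
    simpa [Function.comp_def] using h'

/-- The kernels of a norm continuous family of operators can be straightened near a point at which
the operator has a right inverse. -/
theorem exists_straighten_ker {F G : Type*} [NormedAddCommGroup F]
    [NormedSpace 𝕜 F] [CompleteSpace F] [NormedAddCommGroup G] [NormedSpace 𝕜 G]
    {X : Type*} [TopologicalSpace X] {A : X → (F →L[𝕜] G)}
    {U : Set X} (hU : IsOpen U) (hA : ContinuousOn A U) {x₀ : X} (hx₀ : x₀ ∈ U)
    {R : G →L[𝕜] F} (hR : ∀ g, A x₀ (R g) = g) :
    ∃ U' ⊆ U, IsOpen U' ∧ x₀ ∈ U' ∧ ∃ T : X → (F ≃L[𝕜] F),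
      (∀ x ∈ U', ∀ v, A x₀ (T x v) = A x v) ∧
      ContinuousOn (fun x => (T x : F →L[𝕜] F)) U' ∧
      ContinuousOn (fun x => ((T x).symm : F →L[𝕜] F)) U' := by
  -- For `T x = 1 + R (A x - A x₀)`, the identity `A x₀ ∘ R = 1` gives `A x₀ ∘ T x = A x`.
  obtain ⟨U', hU', hU'o, hxU', T, hT, hTc, hTs⟩ := exists_continuousLinearEquiv_of_eq_id
    (f := fun x => ContinuousLinearMap.id 𝕜 F + R ∘L (A x - A x₀)) hU
    (continuousOn_const.add (continuousOn_const.clm_comp (hA.sub continuousOn_const))) hx₀ (by simp)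
  refine ⟨U', hU', hU'o, hxU', T, fun x hx v => ?_, hTc, hTs⟩
  have h : T x v = v + R (A x v - A x₀ v) := congrArg (fun B : F →L[𝕜] F => B v) (hT x hx)
  rw [h, map_add, hR]
  abel

/-- The ranges of a norm continuous family of operators can be straightened near a point at which
the operator has a left inverse. -/
theorem exists_straighten_range {F M : Type*} [NormedAddCommGroup F]
    [NormedSpace 𝕜 F] [CompleteSpace F] [NormedAddCommGroup M] [NormedSpace 𝕜 M]
    {X : Type*} [TopologicalSpace X] {A : X → (M →L[𝕜] F)}
    {U : Set X} (hU : IsOpen U) (hA : ContinuousOn A U) {x₀ : X} (hx₀ : x₀ ∈ U)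
    {B : F →L[𝕜] M} (hB : ∀ m, B (A x₀ m) = m) :
    ∃ U' ⊆ U, IsOpen U' ∧ x₀ ∈ U' ∧ ∃ T : X → (F ≃L[𝕜] F),
      (∀ x ∈ U', ∀ m, T x (A x m) = A x₀ m) ∧
      ContinuousOn (fun x => (T x : F →L[𝕜] F)) U' := by
  -- The operator `1 + (A x - A x₀) B` sends `A x₀ m` to `A x m`, so the straightening is its
  -- inverse.
  obtain ⟨U', hU', hU'o, hxU', T, hT, hTc, hTs⟩ := exists_continuousLinearEquiv_of_eq_id
    (f := fun x => ContinuousLinearMap.id 𝕜 F + (A x - A x₀) ∘L B) hU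
    (continuousOn_const.add ((hA.sub continuousOn_const).clm_comp continuousOn_const)) hx₀ (by simp)
  refine ⟨U', hU', hU'o, hxU', fun x => (T x).symm, fun x hx m => ?_, hTs⟩
  have h : T x (A x₀ m) = A x₀ m + (A x (B (A x₀ m)) - A x₀ (B (A x₀ m))) :=
    congrArg (fun S : F →L[𝕜] F => S (A x₀ m)) (hT x hx)
  rw [hB] at h
  change (T x).symm (A x m) = _
  rw [ContinuousLinearEquiv.symm_apply_eq, h]
  abel

/-- A σ-compact subset of an infinite dimensional Banach space does not contain any
neighbourhood. -/
theorem IsSigmaCompact.exists_mem_nhds_notMem {F : Type*} [NormedAddCommGroup F]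
    [NormedSpace 𝕜 F] [CompleteSpace F] (hF : ¬ FiniteDimensional 𝕜 F) {B : Set F}
    (hB : IsSigmaCompact B) {N : Set F} {f : F} (hN : N ∈ 𝓝 f) : ∃ j ∈ N, j ∉ B := by
  obtain ⟨K, hK, rfl⟩ := hB
  -- Baire's theorem: a compact set with an interior point contains a closed ball, which Riesz's
  -- theorem forbids in infinite dimensions.
  have hdense : Dense (⋂ n, (K n)ᶜ) := by
    refine dense_iInter_of_isOpen (fun n => (hK n).isClosed.isOpen_compl) fun n => ?_
    rw [← interior_eq_empty_iff_dense_compl, Set.eq_empty_iff_forall_notMem]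
    intro g hg
    obtain ⟨r, hr, hrK⟩ := Metric.nhds_basis_closedBall.mem_iff.1 (mem_interior_iff_mem_nhds.1 hg)
    exact hF (.of_isCompact_closedBall 𝕜 hr
      ((hK n).of_isClosed_subset Metric.isClosed_closedBall hrK))
  obtain ⟨j, hjN, hj⟩ := (dense_iff_inter_open.1 hdense) (interior N) isOpen_interior
    ⟨f, mem_interior_iff_mem_nhds.2 hN⟩
  refine ⟨j, interior_subset hjN, fun hj' => ?_⟩
  obtain ⟨n, hn⟩ := Set.mem_iUnion.1 hj'
  exact Set.mem_iInter.1 hj n hn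

end Operators

/-! ### Fredholm operators -/

section Fredholm

variable {𝕜 : Type*} [RCLike 𝕜]

/-- The kernels of two nonzero continuous functionals are isomorphic. -/
theorem nonempty_ker_equiv_ker {H : Type*} [AddCommGroup H] [Module 𝕜 H] [TopologicalSpace H]
    [IsTopologicalAddGroup H] [ContinuousSMul 𝕜 H] {f g : H →L[𝕜] 𝕜} (hf : f ≠ 0) (hg : g ≠ 0) :
    Nonempty (f.ker ≃L[𝕜] g.ker) := by
  -- A vector space is not the union of two hyperplanes. Along a line `u` in neither kernel, the
  -- projections onto the two kernels are inverse to each other when restricted to them.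
  obtain ⟨u, hfu, hgu⟩ : ∃ u, f u ≠ 0 ∧ g u ≠ 0 := by
    obtain ⟨a, ha⟩ := DFunLike.ne_iff.1 hf
    obtain ⟨b, hb⟩ := DFunLike.ne_iff.1 hg
    rw [zero_apply] at ha hb
    by_cases h : g a = 0
    · by_cases h' : f b = 0
      · exact ⟨a + b, by simpa [h'] using ha, by simpa [h] using hb⟩
      · exact ⟨b, h', hb⟩
    · exact ⟨a, ha, h⟩
  let P : f.ker →L[𝕜] g.ker :=
    (ContinuousLinearMap.id 𝕜 H - ((g u)⁻¹ • g).smulRight u).restrict (p := f.ker) (q := g.ker)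
      fun v _ => by
        change g (v - ((g u)⁻¹ * g v) • u) = 0
        rw [map_sub, map_smul, smul_eq_mul, mul_right_comm, inv_mul_cancel₀ hgu, one_mul, sub_self]
  let Q : g.ker →L[𝕜] f.ker :=
    (ContinuousLinearMap.id 𝕜 H - ((f u)⁻¹ • f).smulRight u).restrict (p := g.ker) (q := f.ker)
      fun v _ => by
        change f (v - ((f u)⁻¹ * f v) • u) = 0
        rw [map_sub, map_smul, smul_eq_mul, mul_right_comm, inv_mul_cancel₀ hfu, one_mul, sub_self]
  have hP : ∀ v : f.ker, (P v : H) = v - ((g u)⁻¹ * g v) • u := fun _ => rfl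
  have hQ : ∀ v : g.ker, (Q v : H) = v - ((f u)⁻¹ * f v) • u := fun _ => rfl
  refine ⟨ContinuousLinearEquiv.equivOfInverse P Q (fun v => ?_) fun v => ?_⟩
  · have hv : f v = 0 := v.2
    apply Subtype.ext
    rw [hQ, hP, map_sub, map_smul, smul_eq_mul, hv, zero_sub, mul_neg, mul_left_comm,
      inv_mul_cancel₀ hfu, mul_one, neg_smul]
    abel
  · have hv : g v = 0 := v.2
    apply Subtype.ext
    rw [hP, hQ, map_sub, map_smul, smul_eq_mul, hv, zero_sub, mul_neg, mul_left_comm,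
      inv_mul_cancel₀ hgu, mul_one, neg_smul]
    abel

/-- A one dimensional summand can be cancelled. -/
theorem nonempty_equiv_of_prod_field_equiv {D D' : Type*} [AddCommGroup D] [Module 𝕜 D]
    [TopologicalSpace D] [IsTopologicalAddGroup D] [ContinuousSMul 𝕜 D] [AddCommGroup D']
    [Module 𝕜 D'] [TopologicalSpace D'] [IsTopologicalAddGroup D'] [ContinuousSMul 𝕜 D']
    (e : (D × 𝕜) ≃L[𝕜] (D' × 𝕜)) : Nonempty (D ≃L[𝕜] D') := by
  -- Through `e`, both `D` and `D'` become kernels of nonzero functionals on the same space `D × 𝕜`.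
  let f := ContinuousLinearMap.snd 𝕜 D 𝕜
  let g := ContinuousLinearMap.snd 𝕜 D' 𝕜 ∘L e.toContinuousLinearMap
  have hf : f ≠ 0 := fun h => one_ne_zero (congrArg (fun φ : D × 𝕜 →L[𝕜] 𝕜 => φ (0, 1)) h)
  have hg : g ≠ 0 := fun h => by
    have h' : g (e.symm (0, 1)) = 0 := by rw [h]; rfl
    simp [g] at h'
  obtain ⟨φ⟩ := nonempty_ker_equiv_ker hf hg
  let a : D ≃L[𝕜] f.ker := ContinuousLinearEquiv.equivOfInverse
    ((ContinuousLinearMap.inl 𝕜 D 𝕜).codRestrict f.ker fun a => rfl)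
    (ContinuousLinearMap.fst 𝕜 D 𝕜 ∘L f.ker.subtypeL)
    (fun a => rfl) fun a => Subtype.ext (Prod.ext rfl (show a.1.2 = 0 from a.2).symm)
  let b : D' ≃L[𝕜] g.ker := ContinuousLinearEquiv.equivOfInverse
    ((e.symm.toContinuousLinearMap ∘L ContinuousLinearMap.inl 𝕜 D' 𝕜).codRestrict g.ker
      fun a => by simp [g])
    (ContinuousLinearMap.fst 𝕜 D' 𝕜 ∘L e.toContinuousLinearMap ∘L g.ker.subtypeL)
    (fun a => congrArg Prod.fst (e.apply_symm_apply (a, 0))) fun a => by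
      apply Subtype.ext
      have h : (e a.1).2 = 0 := a.2
      change e.symm ((e a.1).1, 0) = a.1
      rw [← h]
      exact e.symm_apply_apply a.1
  exact ⟨(a.trans φ).trans b.symm⟩

/-- A finite dimensional summand can be cancelled. -/
theorem nonempty_equiv_of_prod_equiv (n : ℕ) {D D' : Type*} [AddCommGroup D] [Module 𝕜 D]
    [TopologicalSpace D] [IsTopologicalAddGroup D] [ContinuousSMul 𝕜 D] [AddCommGroup D']
    [Module 𝕜 D'] [TopologicalSpace D'] [IsTopologicalAddGroup D'] [ContinuousSMul 𝕜 D']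
    (e : (D × (Fin n → 𝕜)) ≃L[𝕜] (D' × (Fin n → 𝕜))) : Nonempty (D ≃L[𝕜] D') := by
  induction n with
  | zero =>
    exact ⟨((ContinuousLinearEquiv.prodUnique 𝕜 D (Fin 0 → 𝕜)).symm.trans e).trans
      (ContinuousLinearEquiv.prodUnique 𝕜 D' (Fin 0 → 𝕜))⟩
  | succ n ih =>
    let c : (Fin (n + 1) → 𝕜) ≃L[𝕜] ((Fin n → 𝕜) × 𝕜) :=
      ContinuousLinearEquiv.ofFinrankEq (by simp)
    obtain ⟨e'⟩ := nonempty_equiv_of_prod_field_equiv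
      ((ContinuousLinearEquiv.prodAssoc 𝕜 D (Fin n → 𝕜) 𝕜).trans
      ((((ContinuousLinearEquiv.refl 𝕜 D).prodCongr c.symm).trans e).trans
      (((ContinuousLinearEquiv.refl 𝕜 D').prodCongr c).trans
      (ContinuousLinearEquiv.prodAssoc 𝕜 D' (Fin n → 𝕜) 𝕜).symm)))
    exact ih e'

/-- The total `m` is a separate variable tied by an equation, so that the equality of two Fredholm
indices can be supplied as that equation. -/
theorem nonempty_prod_fin_equiv {P : Type*} [AddCommGroup P] [Module 𝕜 P] [TopologicalSpace P]
    (i j m : ℕ) (h : i + j = m) :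
    Nonempty (((P × (Fin i → 𝕜)) × (Fin j → 𝕜)) ≃L[𝕜] (P × (Fin m → 𝕜))) := by
  subst h
  let c : ((Fin i → 𝕜) × (Fin j → 𝕜)) ≃L[𝕜] (Fin (i + j) → 𝕜) :=
    ContinuousLinearEquiv.ofFinrankEq (by simp)
  exact ⟨(ContinuousLinearEquiv.prodAssoc 𝕜 _ _ _).trans
    ((ContinuousLinearEquiv.refl 𝕜 P).prodCongr c)⟩

variable {D M : Type*} [AddCommGroup D] [Module 𝕜 D] [TopologicalSpace D]
  [IsTopologicalAddGroup D] [ContinuousSMul 𝕜 D] [T2Space D]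
  [AddCommGroup M] [Module 𝕜 M] [TopologicalSpace M]
  [IsTopologicalAddGroup M] [ContinuousSMul 𝕜 M] [T2Space M]

/-- A Fredholm operator identifies its source and target up to finite dimensional summands. -/
theorem ContinuousLinearMap.IsFredholm.nonempty_equiv_prod {A : D →L[𝕜] M} (hA : A.IsFredholm) :
    Nonempty ((D × (Fin (Module.finrank 𝕜 (M ⧸ A.range)) → 𝕜)) ≃L[𝕜]
      (M × (Fin (Module.finrank 𝕜 A.ker) → 𝕜))) := by
  -- With complements of kernel and range chosen, `A` identifies the complement of its kernel with
  -- its range, so both products become range × kernel × cokernel.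
  obtain ⟨pkg⟩ := hA.nonempty_fredholmPackage
  have hY : Module.finrank 𝕜 (M ⧸ A.range) = Module.finrank 𝕜 pkg.decCodom.X₀ := by
    rw [pkg.range_eq]
    exact (Submodule.quotientEquivOfIsCompl _ _ pkg.decCodom.isTopCompl.isCompl).finrank_eq
  have := pkg.decDom.finite_X₀
  have := pkg.decCodom.finite_X₀
  let a : (Fin (Module.finrank 𝕜 (M ⧸ A.range)) → 𝕜) ≃L[𝕜] pkg.decCodom.X₀ :=
    ContinuousLinearEquiv.ofFinrankEq (by simp [hY])
  let b : pkg.decDom.X₀ ≃L[𝕜] (Fin (Module.finrank 𝕜 A.ker) → 𝕜) :=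
    ContinuousLinearEquiv.ofFinrankEq (by rw [pkg.ker_eq, Module.finrank_fin_fun])
  let p := Submodule.prodEquivOfIsTopCompl _ _ pkg.decDom.isTopCompl
  let q := Submodule.prodEquivOfIsTopCompl _ _ pkg.decCodom.isTopCompl
  have e₁ : (D × (Fin (Module.finrank 𝕜 (M ⧸ A.range)) → 𝕜)) ≃L[𝕜]
    ((pkg.decCodom.X₁ × pkg.decDom.X₀) × pkg.decCodom.X₀) :=
    (p.symm.trans (pkg.equiv.prodCongr (.refl 𝕜 _))).prodCongr a
  have e₂ : ((pkg.decCodom.X₁ × pkg.decDom.X₀) × pkg.decCodom.X₀) ≃L[𝕜]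
      ((pkg.decCodom.X₁ × pkg.decCodom.X₀) × pkg.decDom.X₀) :=
    (ContinuousLinearEquiv.prodAssoc 𝕜 _ _ _).trans (((ContinuousLinearEquiv.refl 𝕜 _).prodCongr
      (ContinuousLinearEquiv.prodComm 𝕜 _ _)).trans (ContinuousLinearEquiv.prodAssoc 𝕜 _ _ _).symm)
  exact ⟨(e₁.trans e₂).trans (q.prodCongr b)⟩

/-- Banach spaces from which there are Fredholm operators of the same index to a given space are
isomorphic. -/
theorem nonempty_equiv_of_isFredholm {D' M' : Type*} [AddCommGroup D'] [Module 𝕜 D']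
    [TopologicalSpace D'] [IsTopologicalAddGroup D'] [ContinuousSMul 𝕜 D'] [T2Space D']
    [AddCommGroup M'] [Module 𝕜 M'] [TopologicalSpace M']
    [IsTopologicalAddGroup M'] [ContinuousSMul 𝕜 M'] [T2Space M']
    {A : D →L[𝕜] M} {A' : D' →L[𝕜] M'} (hA : A.IsFredholm) (hA' : A'.IsFredholm)
    (h : fredholmIndex A = fredholmIndex A') (e : M ≃L[𝕜] M') : Nonempty (D ≃L[𝕜] D') := by
  obtain ⟨a⟩ := hA.nonempty_equiv_prod
  obtain ⟨a'⟩ := hA'.nonempty_equiv_prod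
  unfold fredholmIndex at h
  generalize Module.finrank 𝕜 (M ⧸ A.range) = c at *
  generalize Module.finrank 𝕜 (M' ⧸ A'.range) = c' at *
  generalize Module.finrank 𝕜 A.ker = n at *
  generalize Module.finrank 𝕜 A'.ker = n' at *
  -- Each identification is stabilized by the cokernel dimension of the other operator. Equality of
  -- indices, in the form `n + c' = n' + c`, then makes both right hand sides agree.
  obtain ⟨hD⟩ := nonempty_prod_fin_equiv (𝕜 := 𝕜) (P := D) c c' (c + c') rfl
  obtain ⟨hM⟩ := nonempty_prod_fin_equiv (𝕜 := 𝕜) (P := M) n c' (n + c') rfl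
  obtain ⟨hD'⟩ := nonempty_prod_fin_equiv (𝕜 := 𝕜) (P := D') c' c (c + c') (add_comm _ _)
  obtain ⟨hM'⟩ := nonempty_prod_fin_equiv (𝕜 := 𝕜) (P := M') n' c (n + c') (by omega)
  have e₁ := (hD.symm.trans (a.prodCongr (.refl 𝕜 (Fin c' → 𝕜)))).trans hM
  have e₂ := (hD'.symm.trans (a'.prodCongr (.refl 𝕜 (Fin c → 𝕜)))).trans hM'
  exact nonempty_equiv_of_prod_equiv (c + c')
    ((e₁.trans (e.prodCongr (.refl 𝕜 (Fin (n + c') → 𝕜)))).trans e₂.symm)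

/-- The restriction of a Fredholm operator `A : E → F` to an operator `A⁻¹(V) → V` is a Fredholm
operator of the same index if `V` is transversal to the image of `A`. -/
theorem ContinuousLinearMap.IsFredholm.restrict_transversal {E F : Type*} [AddCommGroup E]
    [Module 𝕜 E] [TopologicalSpace E] [IsTopologicalAddGroup E] [AddCommGroup F] [Module 𝕜 F]
    [TopologicalSpace F] [IsTopologicalAddGroup F]
    {A : E →L[𝕜] F} (hA : A.IsFredholm) {D : Submodule 𝕜 E} {V : Submodule 𝕜 F}
    (hD : ∀ u, u ∈ D ↔ A u ∈ V) (hV : A.range ⊔ V = ⊤) {B : D →L[𝕜] V}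
    (hB : ∀ u, (B u : F) = A u) : B.IsFredholm ∧ fredholmIndex B = fredholmIndex A := by
  let κ : B.ker ≃ₗ[𝕜] A.ker :=
    { toFun := fun u => ⟨u.1, by
        have h : B u = 0 := u.2
        change A (u : D) = 0
        rw [← hB, h, Submodule.coe_zero]⟩
      invFun := fun u => ⟨⟨u.1, (hD _).2 (by
        have h : A u = 0 := u.2
        rw [h]
        exact V.zero_mem)⟩, Subtype.ext ((hB _).trans u.2)⟩
      map_add' := fun _ _ => rfl
      map_smul' := fun _ _ => rfl
      left_inv := fun _ => rfl
      right_inv := fun _ => rfl }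
  have hrange : ∀ v : V, v ∈ B.range ↔ (v : F) ∈ A.range := by
    refine fun v => ⟨?_, ?_⟩
    · rintro ⟨u, rfl⟩
      exact ⟨u, (hB u).symm⟩
    · rintro ⟨u, hu⟩
      have hu' : A u = v := hu
      exact ⟨⟨u, (hD u).2 (hu' ▸ v.2)⟩, Subtype.ext ((hB _).trans hu')⟩
  -- The cokernels agree: `V` maps onto `F ⧸ A.range` by transversality, and the kernel of this map
  -- is `V ∩ A.range = B.range`.
  let q : V →ₗ[𝕜] F ⧸ A.range := A.range.mkQ ∘ₗ V.subtype
  have hqk : q.ker = B.range := by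
    ext v
    rw [hrange, LinearMap.mem_ker]
    exact Submodule.Quotient.mk_eq_zero _
  have hqs : Function.Surjective q := by
    intro f
    obtain ⟨f, rfl⟩ := Submodule.mkQ_surjective _ f
    obtain ⟨a, ha, v, hv, rfl⟩ := Submodule.mem_sup.1 (show f ∈ A.range ⊔ V from hV ▸ trivial)
    refine ⟨⟨v, hv⟩, ?_⟩
    change A.range.mkQ v = A.range.mkQ (a + v)
    rw [map_add, show A.range.mkQ a = 0 from (Submodule.Quotient.mk_eq_zero _).2 ha, zero_add]
  let ε : (V ⧸ B.range) ≃ₗ[𝕜] F ⧸ A.range :=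
    (Submodule.quotEquivOfEq _ _ hqk.symm).trans (q.quotKerEquivOfSurjective hqs)
  have := hA.finite_ker
  have := hA.finite_coker
  refine ⟨⟨?_, ?_, κ.symm.finiteDimensional, .of_surjective _ ε.symm.surjective, ?_⟩, ?_⟩
  · have hA' : IsOpenMap (Set.rangeFactorization A) :=
      ((AddMonoidHom.isStrictMap_iff_isOpenQuotientMap_rangeRestrict
        (f := A.toLinearMap.toAddMonoidHom)).1 hA.isStrictMap).isOpenMap
    have hB' : IsOpenMap (Set.rangeFactorization B) := by
      rintro _ ⟨O, hO, rfl⟩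
      obtain ⟨P, hP, hPO⟩ := hA' O hO
      refine ⟨Subtype.val ⁻¹' P, hP.preimage continuous_subtype_val, ?_⟩
      ext ⟨_, u, rfl⟩
      have h : A u ∈ P ↔ ∃ a ∈ O, A a = A u := by
        have := Set.ext_iff.1 hPO ⟨A u, u, rfl⟩
        simpa [Set.rangeFactorization, Subtype.ext_iff] using this
      change (B u : F) ∈ P ↔ _
      rw [hB, h]
      constructor
      · rintro ⟨a, ha, hau⟩
        -- Openness onto the range passes to `B` because `D` is the full preimage of `V`: any `a ∈
        -- O` with the same image as `u ∈ D` lies in `D`.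
        have haD : a ∈ D := (hD a).2 (hau ▸ (hD u).1 u.2)
        exact ⟨⟨a, haD⟩, ha, Subtype.ext (Subtype.ext (by simpa [hB] using hau))⟩
      · rintro ⟨a, ha, hau⟩
        refine ⟨a, ha, ?_⟩
        rw [← hB, ← hB]
        exact congrArg Subtype.val (congrArg Subtype.val hau)
    exact hB'.isQuotientMap B.continuous.rangeFactorization Set.rangeFactorization_surjective
  · have h : (B.range : Set V) = Subtype.val ⁻¹' (A.range : Set F) := Set.ext hrange
    rw [h]
    exact hA.isClosed_range.preimage continuous_subtype_val
  · obtain ⟨p, hp⟩ := hA.closedComplemented_ker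
    have hc : Continuous κ.symm :=
      (continuous_subtype_val.subtype_mk _).subtype_mk _
    exact ⟨⟨κ.symm.toLinearMap, hc⟩ ∘L p ∘L D.subtypeL, fun u => congrArg κ.symm (hp (κ u))⟩
  · unfold fredholmIndex
    rw [κ.finrank_eq, ε.finrank_eq]

end Fredholm

/-! ### Charts of vector bundles -/

section Charts

variable (𝕜 : Type w) [RCLike 𝕜] {X : Type u} [TopologicalSpace X]
  (F : Type*) [NormedAddCommGroup F] [NormedSpace 𝕜 F]
  (E : X → Type v) [∀ x, AddCommGroup (E x)] [∀ x, Module 𝕜 (E x)] [∀ x, TopologicalSpace (E x)]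
  [TopologicalSpace (TotalSpace F E)] [FiberBundle F E] [VectorBundle 𝕜 F E]

/-- The domain of the preferred trivialization around `x₀`. -/
def chartDom (x₀ : X) : Set X := (trivializationAt F E x₀).baseSet

/-- The preferred trivialization around `x₀` on the fibre over `x`. -/
def chart (x₀ x : X) : E x →L[𝕜] F := (trivializationAt F E x₀).continuousLinearMapAt 𝕜 x

/-- The inverse of the preferred trivialization around `x₀` on the fibre over `x`. -/
def chartSymm (x₀ x : X) : F →L[𝕜] E x := (trivializationAt F E x₀).symmL 𝕜 x

theorem isOpen_chartDom (x₀ : X) : IsOpen (chartDom F E x₀) := (trivializationAt F E x₀).open_baseSet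

theorem mem_chartDom (x₀ : X) : x₀ ∈ chartDom F E x₀ :=
  FiberBundle.mem_baseSet_trivializationAt F E x₀

variable {F E}

theorem chartSymm_chart {x₀ x : X} (hx : x ∈ chartDom F E x₀) (v : E x) :
    chartSymm 𝕜 F E x₀ x (chart 𝕜 F E x₀ x v) = v :=
  (trivializationAt F E x₀).symmL_continuousLinearMapAt hx v

theorem chart_chartSymm {x₀ x : X} (hx : x ∈ chartDom F E x₀) (w : F) :
    chart 𝕜 F E x₀ x (chartSymm 𝕜 F E x₀ x w) = w :=
  (trivializationAt F E x₀).continuousLinearMapAt_symmL hx w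

theorem chart_apply {x₀ x : X} (hx : x ∈ chartDom F E x₀) (v : E x) :
    chart 𝕜 F E x₀ x v = (trivializationAt F E x₀ ⟨x, v⟩).2 :=
  (trivializationAt F E x₀).continuousLinearMapAt_apply_of_mem 𝕜 hx v

variable (F E) in
/-- The preferred trivialization around `x₀` on the fibre over `x`, as an isomorphism. -/
def chartEquiv {x₀ x : X} (hx : x ∈ chartDom F E x₀) : E x ≃L[𝕜] F :=
  ContinuousLinearEquiv.equivOfInverse (chart 𝕜 F E x₀ x) (chartSymm 𝕜 F E x₀ x)
    (chartSymm_chart 𝕜 hx) (chart_chartSymm 𝕜 hx)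

variable {T : Type*} [TopologicalSpace T]

/-- `chart` is linear on every fibre, including those off its domain, while the trivialization
behind it is only meaningful over the domain. They agree near `t₀`, which is all that continuity
there needs. -/
theorem continuousAt_totalSpace_iff {g : T → TotalSpace F E} {t₀ : T} {x₀ : X}
    (hx : (g t₀).1 ∈ chartDom F E x₀) : ContinuousAt g t₀ ↔
      ContinuousAt (fun t => (g t).1) t₀ ∧
        ContinuousAt (fun t => chart 𝕜 F E x₀ (g t).1 (g t).2) t₀ := by
  have h := (trivializationAt F E x₀).tendsto_nhds_iff (l := 𝓝 t₀) (f := g) (z := g t₀)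
    ((trivializationAt F E x₀).mem_source.2 hx)
  refine h.trans (and_congr_right fun hp => ?_)
  have hev : ∀ᶠ t in 𝓝 t₀, (g t).1 ∈ chartDom F E x₀ :=
    hp ((isOpen_chartDom F E x₀).mem_nhds hx)
  have hz : (trivializationAt F E x₀ (g t₀)).2 = chart 𝕜 F E x₀ (g t₀).1 (g t₀).2 :=
    (chart_apply 𝕜 hx (g t₀).2).symm
  rw [hz]
  exact Filter.tendsto_congr' (hev.mono fun t ht => (chart_apply 𝕜 ht _).symm)

theorem ContinuousAt.chart {g : T → TotalSpace F E} {t₀ : T} (hg : ContinuousAt g t₀) {x₀ : X}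
    (hx : (g t₀).1 ∈ chartDom F E x₀) :
    ContinuousAt (fun t => chart 𝕜 F E x₀ (g t).1 (g t).2) t₀ :=
  ((continuousAt_totalSpace_iff 𝕜 hx).1 hg).2

theorem ContinuousAt.chartSymm {b : T → X} {f : T → F} {t₀ : T} (hb : ContinuousAt b t₀)
    (hf : ContinuousAt f t₀) {x₀ : X} (hx : b t₀ ∈ chartDom F E x₀) :
    ContinuousAt (fun t => (⟨b t, chartSymm 𝕜 F E x₀ (b t) (f t)⟩ : TotalSpace F E)) t₀ := by
  refine (continuousAt_totalSpace_iff 𝕜 (x₀ := x₀) hx).2 ⟨hb, ?_⟩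
  have hev : ∀ᶠ t in 𝓝 t₀, b t ∈ chartDom F E x₀ :=
    hb ((isOpen_chartDom F E x₀).mem_nhds hx)
  exact hf.congr (hev.mono fun t ht => (chart_chartSymm 𝕜 ht _).symm)

theorem ContinuousAt.totalSpace_proj {g : T → TotalSpace F E} {t₀ : T} (hg : ContinuousAt g t₀) :
    ContinuousAt (fun t => (g t).1) t₀ :=
  (FiberBundle.continuous_proj F E).continuousAt.comp hg

theorem ContinuousAt.totalSpace_smul {b : T → X} {c : T → 𝕜} {f : ∀ t, E (b t)} {t₀ : T}
    (hc : ContinuousAt c t₀) (hf : ContinuousAt (fun t => (⟨b t, f t⟩ : TotalSpace F E)) t₀) :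
    ContinuousAt (fun t => (⟨b t, c t • f t⟩ : TotalSpace F E)) t₀ := by
  have hx := mem_chartDom F E (b t₀)
  refine (continuousAt_totalSpace_iff 𝕜 (x₀ := b t₀) hx).2 ⟨hf.totalSpace_proj, ?_⟩
  exact (hc.smul (hf.chart 𝕜 hx)).congr
    (Filter.Eventually.of_forall fun t => (map_smul _ _ _).symm)

theorem Continuous.totalSpace_smul {b : T → X} {c : T → 𝕜} {f : ∀ t, E (b t)}
    (hc : Continuous c) (hf : Continuous (fun t => (⟨b t, f t⟩ : TotalSpace F E))) :
    Continuous (fun t => (⟨b t, c t • f t⟩ : TotalSpace F E)) :=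
  continuous_iff_continuousAt.2 fun _ => hc.continuousAt.totalSpace_smul 𝕜 hf.continuousAt

end Charts

theorem ContinuousAt.totalSpace_add
    (𝕜 : Type w) [RCLike 𝕜] {X : Type u} [TopologicalSpace X]
    {F : Type*} [NormedAddCommGroup F] [NormedSpace 𝕜 F]
    {E : X → Type v} [∀ x, AddCommGroup (E x)] [∀ x, Module 𝕜 (E x)] [∀ x, TopologicalSpace (E x)]
    [TopologicalSpace (TotalSpace F E)] [FiberBundle F E] [VectorBundle 𝕜 F E]
    {T : Type*} [TopologicalSpace T] {b : T → X} {f g : ∀ t, E (b t)} {t₀ : T}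
    (hf : ContinuousAt (fun t => (⟨b t, f t⟩ : TotalSpace F E)) t₀)
    (hg : ContinuousAt (fun t => (⟨b t, g t⟩ : TotalSpace F E)) t₀) :
    ContinuousAt (fun t => (⟨b t, f t + g t⟩ : TotalSpace F E)) t₀ := by
  have hx := mem_chartDom F E (b t₀)
  refine (continuousAt_totalSpace_iff 𝕜 (x₀ := b t₀) hx).2 ⟨hf.totalSpace_proj, ?_⟩
  exact ((hf.chart 𝕜 hx).add (hg.chart 𝕜 hx)).congr
    (Filter.Eventually.of_forall fun t => (map_add _ _ _).symm)

theorem ContinuousAt.totalSpace_zero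
    (𝕜 : Type w) [RCLike 𝕜] {X : Type u} [TopologicalSpace X]
    {F : Type*} [NormedAddCommGroup F] [NormedSpace 𝕜 F]
    {E : X → Type v} [∀ x, AddCommGroup (E x)] [∀ x, Module 𝕜 (E x)] [∀ x, TopologicalSpace (E x)]
    [TopologicalSpace (TotalSpace F E)] [FiberBundle F E] [VectorBundle 𝕜 F E]
    {T : Type*} [TopologicalSpace T] {b : T → X} {t₀ : T} (hb : ContinuousAt b t₀) :
    ContinuousAt (fun t => (⟨b t, 0⟩ : TotalSpace F E)) t₀ := by
  refine (continuousAt_totalSpace_iff 𝕜 (x₀ := b t₀) (mem_chartDom F E (b t₀))).2 ⟨hb, ?_⟩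
  exact continuousAt_const.congr (Filter.Eventually.of_forall fun t => (map_zero _).symm)

theorem Continuous.totalSpace_add
    (𝕜 : Type w) [RCLike 𝕜] {X : Type u} [TopologicalSpace X]
    {F : Type*} [NormedAddCommGroup F] [NormedSpace 𝕜 F]
    {E : X → Type v} [∀ x, AddCommGroup (E x)] [∀ x, Module 𝕜 (E x)] [∀ x, TopologicalSpace (E x)]
    [TopologicalSpace (TotalSpace F E)] [FiberBundle F E] [VectorBundle 𝕜 F E]
    {T : Type*} [TopologicalSpace T] {b : T → X} {f g : ∀ t, E (b t)}
    (hf : Continuous (fun t => (⟨b t, f t⟩ : TotalSpace F E)))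
    (hg : Continuous (fun t => (⟨b t, g t⟩ : TotalSpace F E))) :
    Continuous (fun t => (⟨b t, f t + g t⟩ : TotalSpace F E)) :=
  continuous_iff_continuousAt.2 fun _ => hf.continuousAt.totalSpace_add 𝕜 hg.continuousAt

theorem Continuous.totalSpace_sub
    (𝕜 : Type w) [RCLike 𝕜] {X : Type u} [TopologicalSpace X]
    {F : Type*} [NormedAddCommGroup F] [NormedSpace 𝕜 F]
    {E : X → Type v} [∀ x, AddCommGroup (E x)] [∀ x, Module 𝕜 (E x)] [∀ x, TopologicalSpace (E x)]
    [TopologicalSpace (TotalSpace F E)] [FiberBundle F E] [VectorBundle 𝕜 F E]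
    {T : Type*} [TopologicalSpace T] {b : T → X} {f g : ∀ t, E (b t)}
    (hf : Continuous (fun t => (⟨b t, f t⟩ : TotalSpace F E)))
    (hg : Continuous (fun t => (⟨b t, g t⟩ : TotalSpace F E))) :
    Continuous (fun t => (⟨b t, f t - g t⟩ : TotalSpace F E)) := by
  simpa only [neg_smul, one_smul, ← sub_eq_add_neg] using
    hf.totalSpace_add 𝕜 (Continuous.totalSpace_smul 𝕜 (continuous_const (y := (-1 : 𝕜))) hg)

/-! ### Morphisms in charts -/

namespace BanachMorphism

variable {𝕜 : Type w} [RCLike 𝕜] {X : Type u} [TopologicalSpace X]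
  {F₁ : Type*} [NormedAddCommGroup F₁] [NormedSpace 𝕜 F₁]
  {E₁ : X → Type v} [∀ x, AddCommGroup (E₁ x)] [∀ x, Module 𝕜 (E₁ x)]
  [∀ x, TopologicalSpace (E₁ x)]
  [TopologicalSpace (TotalSpace F₁ E₁)] [FiberBundle F₁ E₁] [VectorBundle 𝕜 F₁ E₁]
  {F₂ : Type*} [NormedAddCommGroup F₂] [NormedSpace 𝕜 F₂]
  {E₂ : X → Type v} [∀ x, AddCommGroup (E₂ x)] [∀ x, Module 𝕜 (E₂ x)]
  [∀ x, TopologicalSpace (E₂ x)]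
  [∀ x, IsTopologicalAddGroup (E₂ x)] [∀ x, ContinuousSMul 𝕜 (E₂ x)]
  [TopologicalSpace (TotalSpace F₂ E₂)] [FiberBundle F₂ E₂] [VectorBundle 𝕜 F₂ E₂]
  (L : BanachMorphism 𝕜 F₁ E₁ F₂ E₂)

/-- A morphism in the charts around `x₀`. -/
def coord (x₀ x : X) : F₁ →L[𝕜] F₂ :=
  chart 𝕜 F₂ E₂ x₀ x ∘L L.toFun x ∘L chartSymm 𝕜 F₁ E₁ x₀ x

theorem coord_apply (x₀ x : X) (v : F₁) :
    L.coord x₀ x v = chart 𝕜 F₂ E₂ x₀ x (L.toFun x (chartSymm 𝕜 F₁ E₁ x₀ x v)) := rfl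

theorem coord_chart {x₀ x : X} (hx : x ∈ chartDom F₁ E₁ x₀) (v : E₁ x) :
    L.coord x₀ x (chart 𝕜 F₁ E₁ x₀ x v) = chart 𝕜 F₂ E₂ x₀ x (L.toFun x v) := by
  rw [coord_apply, chartSymm_chart 𝕜 hx]

/-- The trivialization of the bundle of operators is conjugation by the two charts, so `coord` is
the second component of the continuous section `L` in it. -/
theorem continuousOn_coord (x₀ : X) :
    ContinuousOn (L.coord x₀) (chartDom F₁ E₁ x₀ ∩ chartDom F₂ E₂ x₀) := by
  have h := (trivializationAt (F₁ →L[𝕜] F₂) (fun x => E₁ x →L[𝕜] E₂ x) x₀).continuousOn.comp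
    L.continuous_toFun.continuousOn (s := chartDom F₁ E₁ x₀ ∩ chartDom F₂ E₂ x₀) fun x hx => by
      rw [hom_trivializationAt_source]
      exact hx
  exact continuous_snd.comp_continuousOn h

/-- A family of operators which is norm continuous in the charts is a morphism. -/
def ofCoord (f : ∀ x, E₁ x →L[𝕜] E₂ x)
    (hf : ∀ x₀, ContinuousAt (fun x => chart 𝕜 F₂ E₂ x₀ x ∘L f x ∘L chartSymm 𝕜 F₁ E₁ x₀ x) x₀) :
    BanachMorphism 𝕜 F₁ E₁ F₂ E₂ where
  toFun := f
  continuous_toFun := continuous_iff_continuousAt.2 fun x₀ =>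
    (continuousAt_hom_bundle (RingHom.id 𝕜) _).2 ⟨continuousAt_id, hf x₀⟩

theorem continuous_apply {T : Type*} [TopologicalSpace T] {b : T → X} {f : ∀ t, E₁ (b t)}
    (hf : Continuous fun t => (⟨b t, f t⟩ : TotalSpace F₁ E₁)) :
    Continuous fun t => (⟨b t, L.toFun (b t) (f t)⟩ : TotalSpace F₂ E₂) :=
  (L.continuous_toFun.comp ((FiberBundle.continuous_proj F₁ E₁).comp hf)).clm_bundle_apply hf

end BanachMorphism

/-! ### Subbundles -/

namespace Subbundle

variable {𝕜 : Type w} [RCLike 𝕜] {X : Type u} [TopologicalSpace X]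
  {F : Type*} [NormedAddCommGroup F] [NormedSpace 𝕜 F]
  {E : X → Type v} [∀ x, AddCommGroup (E x)] [∀ x, Module 𝕜 (E x)] [∀ x, TopologicalSpace (E x)]
  [TopologicalSpace (TotalSpace F E)] [FiberBundle F E] [VectorBundle 𝕜 F E]
  (S : Subbundle 𝕜 F E)

theorem isClosed_locModel (x₀ : X) : IsClosed (S.locModel x₀ : Set F) :=
  (S.exists_adapted x₀).choose_spec.1

theorem dom_subset_chartDom (x₀ : X) : S.dom x₀ ⊆ chartDom F E x₀ := S.dom_subset x₀

theorem mem_carrier_iff_chart (x₀ : X) {x : X} (hx : x ∈ S.dom x₀) (v : E x) :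
    v ∈ S.carrier x ↔ S.straight x₀ x (chart 𝕜 F E x₀ x v) ∈ S.locModel x₀ :=
  S.mem_carrier_iff x₀ hx v

theorem continuousAt_straight {T : Type*} [TopologicalSpace T] {g : T → TotalSpace F E} {t₀ : T}
    (hg : ContinuousAt g t₀) {x₀ : X} (hx : (g t₀).1 ∈ S.dom x₀) :
    ContinuousAt (fun t => S.straight x₀ (g t).1 (chart 𝕜 F E x₀ (g t).1 (g t).2)) t₀ := by
  have h := ((S.continuousOn_straight x₀).continuousAt
    ((S.isOpen_dom x₀).mem_nhds hx)).comp (f := fun t => (g t).1) hg.totalSpace_proj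
  exact h.clm_apply (hg.chart 𝕜 (S.dom_subset_chartDom x₀ hx))

/-- The total space of a subbundle is closed. -/
theorem isClosed_total : IsClosed {p : TotalSpace F E | p.2 ∈ S.carrier p.1} := by
  rw [← isOpen_compl_iff, isOpen_iff_mem_nhds]
  intro p hp
  have hx := S.mem_dom p.1
  -- Near `p` the total space of `S` is the preimage of the closed set `locModel` under the
  -- straightened coordinate.
  have h := (S.continuousAt_straight (g := fun q : TotalSpace F E => q) continuousAt_id
    (t₀ := p) hx).eventually_mem ((S.isClosed_locModel p.1).isOpen_compl.mem_nhds
      fun h => hp ((S.mem_carrier_iff_chart p.1 hx p.2).2 h))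
  have h' : ∀ᶠ q : TotalSpace F E in 𝓝 p, q.1 ∈ S.dom p.1 :=
    (FiberBundle.continuous_proj F E).continuousAt ((S.isOpen_dom p.1).mem_nhds hx)
  filter_upwards [h, h'] with q hq hq' hq''
  exact hq ((S.mem_carrier_iff_chart p.1 hq' q.2).1 hq'')

variable [CompleteSpace F]

theorem chart_fiber {x₀ x : X} (hx : x ∈ S.dom x₀) (v : S.Fiber x) :
    chart 𝕜 S.model S.Fiber x₀ x v = S.toModel x₀ hx v := by
  rw [chart_apply 𝕜 (show x ∈ chartDom S.model S.Fiber x₀ from hx)]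
  exact congrArg Prod.snd (S.pretriv_apply x₀ hx v)

theorem straight_chart_incl {x₀ x : X} (hx : x ∈ S.dom x₀) (v : S.Fiber x) :
    S.straight x₀ x (chart 𝕜 F E x₀ x (S.incl x v)) =
      S.locEquiv x₀ (chart 𝕜 S.model S.Fiber x₀ x v) := by
  rw [S.chart_fiber hx, coe_locEquiv_toModel]
  rfl

theorem chart_incl {x₀ x : X} (hx : x ∈ S.dom x₀) (v : S.Fiber x) :
    chart 𝕜 F E x₀ x (S.incl x v) =
      (S.straight x₀ x).symm (S.locEquiv x₀ (chart 𝕜 S.model S.Fiber x₀ x v)) := by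
  rw [← S.straight_chart_incl hx, ContinuousLinearEquiv.symm_apply_apply]

theorem isInducing_subtype_locEquiv (x₀ : X) :
    IsInducing (fun w : S.model => (S.locEquiv x₀ w : F)) :=
  IsInducing.subtypeVal.comp (S.locEquiv x₀).toHomeomorph.isInducing

/-- A map to the total space of a subbundle is continuous if it is so as a map to the total space of
the ambient bundle. -/
theorem continuousAt_fiber_iff {T : Type*} [TopologicalSpace T] {b : T → X}
    {f : ∀ t, S.Fiber (b t)} {t₀ : T} :
    ContinuousAt (fun t => (⟨b t, f t⟩ : TotalSpace S.model S.Fiber)) t₀ ↔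
      ContinuousAt (fun t => (⟨b t, S.incl (b t) (f t)⟩ : TotalSpace F E)) t₀ := by
  have hx := S.mem_dom (b t₀)
  have hx' : b t₀ ∈ chartDom S.model S.Fiber (b t₀) := hx
  rw [continuousAt_totalSpace_iff 𝕜 (g := fun t => (⟨b t, f t⟩ : TotalSpace S.model S.Fiber)) hx',
    continuousAt_totalSpace_iff 𝕜 (x₀ := b t₀) (mem_chartDom F E (b t₀))]
  refine and_congr_right fun hb => ?_
  have hb' : ContinuousAt b t₀ := hb
  have hev : ∀ᶠ t in 𝓝 t₀, b t ∈ S.dom (b t₀) := hb' ((S.isOpen_dom (b t₀)).mem_nhds hx)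
  rw [(S.isInducing_subtype_locEquiv (b t₀)).continuousAt_iff]
  -- The coordinates in `S` and in the ambient bundle differ by the straightening automorphisms,
  -- which are norm continuous together with their inverses.
  have h₁ := ((S.continuousOn_straight (b t₀)).continuousAt
    ((S.isOpen_dom _).mem_nhds hx)).comp hb'
  have h₂ := ((S.continuousOn_straight_symm (b t₀)).continuousAt
    ((S.isOpen_dom _).mem_nhds hx)).comp hb'
  constructor
  · intro h
    exact (h₂.clm_apply h).congr (hev.mono fun t ht => (S.chart_incl ht (f t)).symm)
  · intro h
    exact (h₁.clm_apply h).congr (hev.mono fun t ht => S.straight_chart_incl ht (f t))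

theorem continuous_fiber_iff {T : Type*} [TopologicalSpace T] {b : T → X}
    {f : ∀ t, S.Fiber (b t)} :
    Continuous (fun t => (⟨b t, f t⟩ : TotalSpace S.model S.Fiber)) ↔
      Continuous (fun t => (⟨b t, S.incl (b t) (f t)⟩ : TotalSpace F E)) := by
  simp only [continuous_iff_continuousAt, S.continuousAt_fiber_iff]

theorem continuous_incl :
    Continuous (fun p : TotalSpace S.model S.Fiber => (⟨p.1, S.incl p.1 p.2⟩ : TotalSpace F E)) :=
  (S.continuous_fiber_iff (b := fun p : TotalSpace S.model S.Fiber => p.1)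
    (f := fun p => p.2)).1 continuous_id

end Subbundle

theorem Submodule.ClosedComplemented.of_equiv {𝕜 : Type*} [RCLike 𝕜] {E F : Type*}
    [AddCommGroup E] [Module 𝕜 E] [TopologicalSpace E] [AddCommGroup F] [Module 𝕜 F]
    [TopologicalSpace F] {p : Submodule 𝕜 E} (hp : p.ClosedComplemented) (e : E ≃L[𝕜] F)
    {p' : Submodule 𝕜 F} (h : ∀ v, v ∈ p ↔ e v ∈ p') : p'.ClosedComplemented := by
  obtain ⟨f, hf⟩ := hp
  refine ⟨(e.toContinuousLinearMap ∘L p.subtypeL ∘L f ∘L e.symm.toContinuousLinearMap).codRestrict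
    p' fun w => (h _).1 (f (e.symm w)).2, fun w => ?_⟩
  have hw : e.symm w ∈ p := (h _).2 (by simp)
  apply Subtype.ext
  change e (f (e.symm w)) = w
  rw [show f (e.symm w) = _ from hf ⟨e.symm w, hw⟩]
  exact e.apply_symm_apply _

/-- Subspaces which correspond to each other under an isomorphism are isomorphic. -/
def Submodule.equivOfEquiv {𝕜 : Type*} [RCLike 𝕜] {E F : Type*}
    [AddCommGroup E] [Module 𝕜 E] [TopologicalSpace E] [AddCommGroup F] [Module 𝕜 F]
    [TopologicalSpace F] (p : Submodule 𝕜 E) (e : E ≃L[𝕜] F)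
    (p' : Submodule 𝕜 F) (h : ∀ v, v ∈ p ↔ e v ∈ p') : p ≃L[𝕜] p' :=
  ContinuousLinearEquiv.equivOfInverse
    ((e.toContinuousLinearMap ∘L p.subtypeL).codRestrict p' fun v => (h v).1 v.2)
    ((e.symm.toContinuousLinearMap ∘L p'.subtypeL).codRestrict p fun v => (h _).2 (by simp))
    (fun v => Subtype.ext (e.symm_apply_apply v)) fun v => Subtype.ext (e.apply_symm_apply v)

/-! ### Construction of subbundles -/

namespace Subbundle

variable {𝕜 : Type w} [RCLike 𝕜] {X : Type u} [TopologicalSpace X]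
  {F : Type*} [NormedAddCommGroup F] [NormedSpace 𝕜 F]
  {E : X → Type v} [∀ x, AddCommGroup (E x)] [∀ x, Module 𝕜 (E x)] [∀ x, TopologicalSpace (E x)]
  [TopologicalSpace (TotalSpace F E)] [FiberBundle F E] [VectorBundle 𝕜 F E]

/-- A family of subspaces which can be straightened locally is a subbundle. -/
theorem exists_of_adapted (carrier : ∀ x, Submodule 𝕜 (E x)) (V₀ : X → Submodule 𝕜 F)
    (hV₀ : ∀ x, IsClosed (V₀ x : Set F)) (hiso : ∀ x y, Nonempty (V₀ x ≃L[𝕜] V₀ y))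
    (h : ∀ x₀, ∃ U : Set X, IsOpen U ∧ x₀ ∈ U ∧ U ⊆ chartDom F E x₀ ∧
      ∃ T : X → (F ≃L[𝕜] F), ContinuousOn (fun x => (T x : F →L[𝕜] F)) U ∧
        ∀ x ∈ U, ∀ v : E x, v ∈ carrier x ↔ T x (chart 𝕜 F E x₀ x v) ∈ V₀ x₀) :
    ∃ S : Subbundle 𝕜 F E, S.carrier = carrier ∧
      ((∀ x, FiniteDimensional 𝕜 (V₀ x)) → FiniteDimensional 𝕜 S.model) := by
  -- Over an empty base there is no point to supply a model fibre, and `⊥` serves instead.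
  rcases isEmpty_or_nonempty X with hX | ⟨⟨x₁⟩⟩
  · exact ⟨⟨carrier, ⊥, by simp, fun x => isEmptyElim x⟩, rfl, fun _ => inferInstance⟩
  · exact ⟨⟨carrier, V₀ x₁, hV₀ x₁, fun x₀ => ⟨V₀ x₀, hV₀ x₀, hiso x₁ x₀, h x₀⟩⟩, rfl,
      fun h => h x₁⟩

/-- A family of finite dimensional subspaces which has local frames is a subbundle. -/
theorem exists_of_frames [CompleteSpace F] (carrier : ∀ x, Submodule 𝕜 (E x)) {M : Type*}
    [NormedAddCommGroup M] [NormedSpace 𝕜 M] [FiniteDimensional 𝕜 M]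
    (h : ∀ x₀, ∃ U : Set X, IsOpen U ∧ x₀ ∈ U ∧ U ⊆ chartDom F E x₀ ∧
      ∃ A : X → (M →L[𝕜] F), ContinuousOn A U ∧ Function.Injective (A x₀) ∧
        ∀ x ∈ U, ∀ v : E x, v ∈ carrier x ↔ ∃ m, A x m = chart 𝕜 F E x₀ x v) :
    ∃ S : Subbundle 𝕜 F E, S.carrier = carrier ∧ FiniteDimensional 𝕜 S.model := by
  have : CompleteSpace M := FiniteDimensional.complete 𝕜 M
  choose U hU hxU hUc A hA hinj hmem using h
  have hfin : ∀ x, FiniteDimensional 𝕜 (A x x).range := fun x => inferInstance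
  have hM : ∀ x, Nonempty (M ≃L[𝕜] (A x x).range) := fun x =>
    ⟨(LinearEquiv.ofInjective (A x x).toLinearMap (hinj x)).toContinuousLinearEquiv⟩
  obtain ⟨S, hS, hS'⟩ := exists_of_adapted carrier (fun x => (A x x).range)
    (fun x => Submodule.closed_of_finiteDimensional _)
    (fun x y => ⟨(hM x).some.symm.trans (hM y).some⟩) fun x₀ => by
      -- A projection onto the finite dimensional range followed by the inverse of the frame.
      -- Injectivity at `x₀` alone is enough, since the left inverse straightens the nearby ranges.
      obtain ⟨B, hB⟩ : ∃ B : F →L[𝕜] M, ∀ m, B (A x₀ x₀ m) = m := by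
        obtain ⟨f, hf⟩ := Submodule.ClosedComplemented.of_finiteDimensional (A x₀ x₀).range
        let e := LinearEquiv.ofInjective (A x₀ x₀).toLinearMap (hinj x₀)
        refine ⟨e.symm.toContinuousLinearEquiv.toContinuousLinearMap ∘L f, fun m => ?_⟩
        exact (congrArg e.symm (hf (e m))).trans (e.symm_apply_apply m)
      obtain ⟨U', hU'U, hU', hxU', T, hT, hTc⟩ :=
        exists_straighten_range (hU x₀) (hA x₀) (hxU x₀) hB
      refine ⟨U', hU', hxU', hU'U.trans (hUc x₀), T, hTc, fun x hx v => ?_⟩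
      rw [hmem x₀ x (hU'U hx)]
      constructor
      · rintro ⟨m, hm⟩
        exact ⟨m, by rw [← hm, hT x hx]; rfl⟩
      · rintro ⟨m, hm⟩
        exact ⟨m, (T x).injective (by rw [hT x hx]; exact hm)⟩
  exact ⟨S, hS, hS' hfin⟩

variable (S : Subbundle 𝕜 F E)

/-- The chosen adapted trivialization around `x`, on the fibre over `x`. -/
def fiberEquivModel (x : X) : S.carrier x ≃L[𝕜] S.model :=
  ContinuousLinearEquiv.equivOfInverse (S.toModel x (S.mem_dom x)) (S.fromModel x (S.mem_dom x))
    (S.fromModel_toModel x (S.mem_dom x)) (S.toModel_fromModel x (S.mem_dom x))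

theorem finiteDimensional_carrier (h : FiniteDimensional 𝕜 S.model) (x : X) :
    FiniteDimensional 𝕜 (S.carrier x) :=
  (S.fiberEquivModel x).symm.toLinearEquiv.finiteDimensional

end Subbundle

/-! ### Preimages of transversal subbundles -/

namespace BanachMorphism

variable {𝕜 : Type w} [RCLike 𝕜] {X : Type u} [TopologicalSpace X]
  {F₁ : Type*} [NormedAddCommGroup F₁] [NormedSpace 𝕜 F₁]
  {E₁ : X → Type v} [∀ x, AddCommGroup (E₁ x)] [∀ x, Module 𝕜 (E₁ x)]
  [∀ x, TopologicalSpace (E₁ x)]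
  [TopologicalSpace (TotalSpace F₁ E₁)] [FiberBundle F₁ E₁] [VectorBundle 𝕜 F₁ E₁]
  {F₂ : Type*} [NormedAddCommGroup F₂] [NormedSpace 𝕜 F₂]
  {E₂ : X → Type v} [∀ x, AddCommGroup (E₂ x)] [∀ x, Module 𝕜 (E₂ x)]
  [∀ x, TopologicalSpace (E₂ x)]
  [∀ x, IsTopologicalAddGroup (E₂ x)] [∀ x, ContinuousSMul 𝕜 (E₂ x)]
  [TopologicalSpace (TotalSpace F₂ E₂)] [FiberBundle F₂ E₂] [VectorBundle 𝕜 F₂ E₂]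
  {L : BanachMorphism 𝕜 F₁ E₁ F₂ E₂} {V : Subbundle 𝕜 F₂ E₂}

theorem mem_preimage {x : X} {v : E₁ x} : v ∈ L.preimage V x ↔ L.toFun x v ∈ V.carrier x := Iff.rfl

theorem mem_preimage_iff_coord {x₀ x : X} (hx : x ∈ V.dom x₀) (hx' : x ∈ chartDom F₁ E₁ x₀)
    (v : E₁ x) : v ∈ L.preimage V x ↔
      V.straight x₀ x (L.coord x₀ x (chart 𝕜 F₁ E₁ x₀ x v)) ∈ V.locModel x₀ := by
  rw [mem_preimage, V.mem_carrier_iff_chart x₀ hx, L.coord_chart hx']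

section

variable [CompleteSpace F₁] [CompleteSpace F₂]

/-- If `V` is transversal to the image of `L`, the operators from `F₁` to the quotient of `F₂` by
the local model of `V` are, up to automorphisms of `F₁`, locally constant. -/
theorem exists_straighten (hLV : L.Transversal V) (hc : ∀ x, (L.preimage V x).ClosedComplemented)
    (x₀ : X) : ∃ U : Set X, IsOpen U ∧ x₀ ∈ U ∧ U ⊆ V.dom x₀ ∧ U ⊆ chartDom F₁ E₁ x₀ ∧
      ∃ (G : F₁ →L[𝕜] (F₂ ⧸ V.locModel x₀)) (R : F₂ →L[𝕜] F₁) (T : X → (F₁ ≃L[𝕜] F₁)),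
      (∀ f, G (R f) = (V.locModel x₀).mkQ f) ∧
      (∀ x ∈ U, ∀ w, G (T x w) = (V.locModel x₀).mkQ (V.straight x₀ x (L.coord x₀ x w))) ∧
      ContinuousOn (fun x => (T x : F₁ →L[𝕜] F₁)) U ∧
      ContinuousOn (fun x => ((T x).symm : F₁ →L[𝕜] F₁)) U := by
  have hcl := V.isClosed_locModel x₀
  have : IsClosed ((V.locModel x₀ : Submodule 𝕜 F₂) : Set F₂) := hcl
  let q : F₂ →L[𝕜] (F₂ ⧸ V.locModel x₀) := (V.locModel x₀).mkQL
  have hq : ∀ f, q f = 0 ↔ f ∈ V.locModel x₀ := fun f => Submodule.Quotient.mk_eq_zero _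
  -- Modulo the straightened `V`, the kernel of `L` in coordinates is exactly the preimage of `V`;
  -- transversality at `x₀` becomes surjectivity of `A x₀`.
  let A : X → (F₁ →L[𝕜] (F₂ ⧸ V.locModel x₀)) := fun x =>
    q ∘L (V.straight x₀ x : F₂ →L[𝕜] F₂) ∘L L.coord x₀ x
  have hU : IsOpen (V.dom x₀ ∩ chartDom F₁ E₁ x₀) :=
    (V.isOpen_dom x₀).inter (isOpen_chartDom F₁ E₁ x₀)
  have hA : ContinuousOn A (V.dom x₀ ∩ chartDom F₁ E₁ x₀) :=
    continuousOn_const.clm_comp (((V.continuousOn_straight x₀).mono Set.inter_subset_left).clm_comp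
      ((L.continuousOn_coord x₀).mono fun x hx => ⟨hx.2, V.dom_subset_chartDom x₀ hx.1⟩))
  have hx₀ : x₀ ∈ V.dom x₀ ∩ chartDom F₁ E₁ x₀ := ⟨V.mem_dom x₀, mem_chartDom F₁ E₁ x₀⟩
  have hx₂ := mem_chartDom F₂ E₂ x₀
  have hsurj : Function.Surjective (A x₀) := by
    intro g
    obtain ⟨f, rfl⟩ := Submodule.mkQ_surjective _ g
    obtain ⟨_, ⟨a, rfl⟩, c, hc', hac⟩ := Submodule.mem_sup.1
      (show chartSymm 𝕜 F₂ E₂ x₀ x₀ ((V.straight x₀ x₀).symm f) ∈ _ from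
        hLV x₀ ▸ Submodule.mem_top)
    refine ⟨chart 𝕜 F₁ E₁ x₀ x₀ a, ?_⟩
    change q (V.straight x₀ x₀ (L.coord x₀ x₀ _)) = q f
    have hac' : L.toFun x₀ a = chartSymm 𝕜 F₂ E₂ x₀ x₀ ((V.straight x₀ x₀).symm f) - c :=
      eq_sub_of_add_eq hac
    rw [L.coord_chart hx₀.2, hac', map_sub, map_sub, chart_chartSymm 𝕜 hx₂,
      ContinuousLinearEquiv.apply_symm_apply, map_sub,
      (hq _).2 ((V.mem_carrier_iff_chart x₀ hx₀.1 c).1 hc'), sub_zero]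
  have hker : (A x₀).ker.ClosedComplemented :=
    (hc x₀).of_equiv (chartEquiv 𝕜 F₁ E₁ hx₀.2) fun v => by
      rw [mem_preimage_iff_coord hx₀.1 hx₀.2, ← hq]
      rfl
  obtain ⟨R, hR⟩ := (A x₀).exists_rightInverse_of_closedComplemented_ker hsurj hker
  obtain ⟨U, hUU, hUo, hxU, T, hT, hTc, hTs⟩ := exists_straighten_ker hU hA hx₀ hR
  exact ⟨U, hUo, hxU, fun x hx => (hUU hx).1, fun x hx => (hUU hx).2, A x₀, R ∘L q, T,
    fun f => hR _, hT, hTc, hTs⟩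

/-- `D` is a variable with an equation so that this applies both to the preimage itself and to the
fibre of a subbundle known only to be equal to it. -/
theorem isFredholm_restrict_preimage (hLV : L.Transversal V) [∀ x, IsTopologicalAddGroup (E₁ x)]
    {x : X} (hL : (L.toFun x).IsFredholm)
    {D : Submodule 𝕜 (E₁ x)} (hD : D = L.preimage V x) {B : D →L[𝕜] V.carrier x}
    (hB : ∀ u, (B u : E₂ x) = L.toFun x u) :
    B.IsFredholm ∧ fredholmIndex B = fredholmIndex (L.toFun x) :=
  hL.restrict_transversal (fun u => by rw [hD]; rfl) (hLV x) hB

end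

end BanachMorphism

theorem t2Space_fiber (𝕜 : Type w) [RCLike 𝕜] {X : Type u} [TopologicalSpace X]
    (F : Type*) [NormedAddCommGroup F] [NormedSpace 𝕜 F]
    (E : X → Type v) [∀ x, AddCommGroup (E x)] [∀ x, Module 𝕜 (E x)] [∀ x, TopologicalSpace (E x)]
    [TopologicalSpace (TotalSpace F E)] [FiberBundle F E] [VectorBundle 𝕜 F E] (x : X) :
    T2Space (E x) :=
  (chartEquiv 𝕜 F E (mem_chartDom F E x)).toHomeomorph.isEmbedding.t2Space

theorem finiteDimensional_of_ker {𝕜 A B : Type*} [Field 𝕜] [AddCommGroup A] [Module 𝕜 A]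
    [AddCommGroup B] [Module 𝕜 B] [FiniteDimensional 𝕜 B] (f : A →ₗ[𝕜] B)
    (hf : FiniteDimensional 𝕜 f.ker) : FiniteDimensional 𝕜 A := by
  have : FiniteDimensional 𝕜 (A ⧸ f.ker) := f.quotKerEquivRange.symm.finiteDimensional
  exact Module.Finite.of_submodule_quotient f.ker

namespace BanachMorphism

variable {𝕜 : Type w} [RCLike 𝕜] {X : Type u} [TopologicalSpace X]
  {F₁ : Type*} [NormedAddCommGroup F₁] [NormedSpace 𝕜 F₁] [CompleteSpace F₁]
  {E₁ : X → Type v} [∀ x, AddCommGroup (E₁ x)] [∀ x, Module 𝕜 (E₁ x)]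
  [∀ x, TopologicalSpace (E₁ x)]
  [TopologicalSpace (TotalSpace F₁ E₁)] [FiberBundle F₁ E₁] [VectorBundle 𝕜 F₁ E₁]
  {F₂ : Type*} [NormedAddCommGroup F₂] [NormedSpace 𝕜 F₂] [CompleteSpace F₂]
  {E₂ : X → Type v} [∀ x, AddCommGroup (E₂ x)] [∀ x, Module 𝕜 (E₂ x)]
  [∀ x, TopologicalSpace (E₂ x)]
  [∀ x, IsTopologicalAddGroup (E₂ x)] [∀ x, ContinuousSMul 𝕜 (E₂ x)]
  [TopologicalSpace (TotalSpace F₂ E₂)] [FiberBundle F₂ E₂] [VectorBundle 𝕜 F₂ E₂]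
  {L : BanachMorphism 𝕜 F₁ E₁ F₂ E₂} {V : Subbundle 𝕜 F₂ E₂}

/-- The restriction of `L` to the preimage has values in the finite dimensional fibre of `V`, and
its kernel embeds in the finite dimensional kernel of `L`. -/
theorem finiteDimensional_preimage {x : X} (hL : (L.toFun x).IsFredholm)
    (hV : FiniteDimensional 𝕜 (V.carrier x)) : FiniteDimensional 𝕜 (L.preimage V x) := by
  have := hL.finite_ker
  let B : L.preimage V x →ₗ[𝕜] V.carrier x :=
    (L.toFun x).toLinearMap.restrict fun u hu => hu
  let κ : B.ker →ₗ[𝕜] (L.toFun x).ker :=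
    { toFun := fun u => ⟨u.1, congrArg Subtype.val (show B u = 0 from u.2)⟩
      map_add' := fun _ _ => rfl
      map_smul' := fun _ _ => rfl }
  have hκ : Function.Injective κ := fun a b h =>
    Subtype.ext (Subtype.ext (congrArg (fun z : (L.toFun x).ker => (z : E₁ x)) h))
  exact finiteDimensional_of_ker B (.of_injective κ hκ)

/-- If a subbundle `V` is transversal to the image of a Fredholm morphism `L` and the spaces
`L⁻¹(V)` are complemented, they form a subbundle. -/
theorem exists_subbundle_preimage [∀ x, IsTopologicalAddGroup (E₁ x)]
    [∀ x, ContinuousSMul 𝕜 (E₁ x)] (hL : L.IsFredholm)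
    (hLV : L.Transversal V) (hc : ∀ x, (L.preimage V x).ClosedComplemented) :
    ∃ D : Subbundle 𝕜 F₁ E₁, (∀ x, D.carrier x = L.preimage V x) ∧
      (FiniteDimensional 𝕜 V.model → FiniteDimensional 𝕜 D.model) := by
  have hT₁ := t2Space_fiber 𝕜 F₁ E₁
  have hT₂ := t2Space_fiber 𝕜 F₂ E₂
  obtain ⟨k, hk⟩ := hL
  choose U hU hxU hUV hUc G R T hGR hGT hT hTs using fun x₀ => exists_straighten hLV hc x₀
  have hmem : ∀ x₀, ∀ x ∈ U x₀, ∀ v : E₁ x, v ∈ L.preimage V x ↔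
      T x₀ x (chart 𝕜 F₁ E₁ x₀ x v) ∈ (G x₀).ker := by
    intro x₀ x hx v
    rw [mem_preimage_iff_coord (hUV x₀ hx) (hUc x₀ hx), LinearMap.mem_ker]
    refine Iff.trans ?_ (Eq.congr_left (hGT x₀ x hx _)).symm
    exact (Submodule.Quotient.mk_eq_zero _).symm
  have e : ∀ x, L.preimage V x ≃L[𝕜] (G x).ker := fun x =>
    Submodule.equivOfEquiv _ ((chartEquiv 𝕜 F₁ E₁ (mem_chartDom F₁ E₁ x)).trans (T x x)) _
      fun v => hmem x x (hxU x) v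
  let B : ∀ x, L.preimage V x →L[𝕜] V.carrier x := fun x =>
    (L.toFun x).restrict fun u hu => hu
  have hB : ∀ x, (B x).IsFredholm ∧ fredholmIndex (B x) = fredholmIndex (L.toFun x) := fun x =>
    isFredholm_restrict_preimage hLV (hk x).1 rfl fun u => rfl
  -- Local straightening compares nearby fibres only. Across components of `X` it is the common
  -- Fredholm index that forces the fibres to be isomorphic.
  have hiso : ∀ x x', Nonempty (L.preimage V x ≃L[𝕜] L.preimage V x') := fun x x' =>
    nonempty_equiv_of_isFredholm (hB x).1 (hB x').1
      (by rw [(hB x).2, (hB x').2, (hk x).2, (hk x').2])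
      ((V.fiberEquivModel x).trans (V.fiberEquivModel x').symm)
  obtain ⟨D, hD, hD'⟩ := Subbundle.exists_of_adapted (L.preimage V) (fun x => (G x).ker)
    (fun x => by
      have : IsClosed ((V.locModel x : Submodule 𝕜 F₂) : Set F₂) := V.isClosed_locModel x
      exact (G x).isClosed_ker)
    (fun x x' => ⟨((e x).symm.trans (hiso x x').some).trans (e x')⟩)
    fun x₀ => ⟨U x₀, hU x₀, hxU x₀, hUc x₀, T x₀, hT x₀, hmem x₀⟩
  refine ⟨D, fun x => by rw [hD], fun hV => hD' fun x => ?_⟩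
  have := finiteDimensional_preimage (hk x).1 (V.finiteDimensional_carrier hV x)
  exact (e x).toLinearEquiv.finiteDimensional

/-- Finite dimensional subspaces of a normed space are complemented. The fibre carries only a
topology, so the argument is made in a chart. -/
theorem closedComplemented_preimage (hL : L.IsFredholm) (hV : FiniteDimensional 𝕜 V.model)
    (x : X) : (L.preimage V x).ClosedComplemented := by
  obtain ⟨k, hk⟩ := hL
  have := finiteDimensional_preimage (hk x).1 (V.finiteDimensional_carrier hV x)
  let e := chartEquiv 𝕜 F₁ E₁ (mem_chartDom F₁ E₁ x)
  have h : FiniteDimensional 𝕜 ((L.preimage V x).map e.toLinearEquiv.toLinearMap) := inferInstance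
  exact (Submodule.ClosedComplemented.of_finiteDimensional
    ((L.preimage V x).map e.toLinearEquiv.toLinearMap)).of_equiv e.symm fun w => by
      constructor
      · rintro ⟨v, hv, rfl⟩
        exact (e.symm_apply_apply v).symm ▸ hv
      · intro h
        exact ⟨_, h, e.apply_symm_apply w⟩

variable (L V) in
/-- The restriction of a morphism to the preimage of a subbundle. -/
def restrictPreimage (D : Subbundle 𝕜 F₁ E₁) (hD : ∀ x, D.carrier x = L.preimage V x) :
    BanachMorphism 𝕜 D.model D.Fiber V.model V.Fiber :=
  ofCoord (fun x => (L.toFun x ∘L D.incl x).codRestrict (V.carrier x) fun u =>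
    (hD x).le (D.incl_mem u)) fun x₀ => by
  have hU : IsOpen (D.dom x₀ ∩ V.dom x₀) := (D.isOpen_dom x₀).inter (V.isOpen_dom x₀)
  refine ContinuousOn.continuousAt ?_ (hU.mem_nhds ⟨D.mem_dom x₀, V.mem_dom x₀⟩)
  -- Seen in `F₂`, the restriction is `coord` between the inverse straightening of `D` and the
  -- straightening of `V`, a composition of norm continuous families.
  have key : ContinuousOn (fun x => (V.locEquiv x₀).toContinuousLinearMap ∘L
      (chart 𝕜 V.model V.Fiber x₀ x ∘L ((L.toFun x ∘L D.incl x).codRestrict (V.carrier x) fun u =>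
        (hD x).le (D.incl_mem u)) ∘L chartSymm 𝕜 D.model D.Fiber x₀ x))
      (D.dom x₀ ∩ V.dom x₀) := by
    apply Subbundle.continuousOn_of_subtypeL
    have hL := (L.continuousOn_coord x₀).mono
      (Set.inter_subset_inter (D.dom_subset_chartDom x₀) (V.dom_subset_chartDom x₀))
    have h₁ := (V.continuousOn_straight x₀).mono (Set.inter_subset_right (s := D.dom x₀))
    have h₂ := (D.continuousOn_straight_symm x₀).mono (Set.inter_subset_left (t := V.dom x₀))
    refine (h₁.clm_comp (hL.clm_comp (h₂.clm_comp (continuousOn_const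
      (c := (D.locModel x₀).subtypeL ∘L (D.locEquiv x₀).toContinuousLinearMap))))).congr
        fun x hx => ?_
    ext w
    have hx' : x ∈ chartDom D.model D.Fiber x₀ := hx.1
    change (V.locEquiv x₀ (chart 𝕜 V.model V.Fiber x₀ x _) : F₂) = V.straight x₀ x (L.coord x₀ x
      ((D.straight x₀ x).symm (D.locEquiv x₀ w)))
    rw [← V.straight_chart_incl hx.2]
    congr 1
    nth_rewrite 2 [← chart_chartSymm 𝕜 hx' w]
    rw [← D.chart_incl hx.1, L.coord_chart (D.dom_subset_chartDom x₀ hx.1)]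
    rfl
  refine ((continuousOn_const (c := (V.locEquiv x₀).symm.toContinuousLinearMap)).clm_comp
    key).congr fun x hx => ?_
  refine DFunLike.ext _ _ fun w => ?_
  exact ((V.locEquiv x₀).symm_apply_apply _).symm

theorem isFredholm_restrictPreimage [∀ x, IsTopologicalAddGroup (E₁ x)] (hL : L.IsFredholm)
    (hLV : L.Transversal V) (D : Subbundle 𝕜 F₁ E₁) (hD : ∀ x, D.carrier x = L.preimage V x) :
    (L.restrictPreimage V D hD).IsFredholm := by
  obtain ⟨k, hk⟩ := hL
  refine ⟨k, fun x => ?_⟩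
  have h := isFredholm_restrict_preimage hLV (hk x).1 (hD x)
    (B := (L.restrictPreimage V D hD).toFun x) fun u => rfl
  exact ⟨h.1, h.2.trans (hk x).2⟩

/-! ### Global right inverses modulo a transversal subbundle -/

/-- If `V` is transversal to the image of `L`, then `L` has a right inverse modulo `V`. -/
theorem exists_rightInverse_mod [CompactSpace X] [T2Space X] (hLV : L.Transversal V)
    (hc : ∀ x, (L.preimage V x).ClosedComplemented) :
    ∃ σ : ∀ x, E₂ x → E₁ x, (∀ x, IsLinearMap 𝕜 (σ x)) ∧
      (Continuous fun p : TotalSpace F₂ E₂ => (⟨p.1, σ p.1 p.2⟩ : TotalSpace F₁ E₁)) ∧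
      ∀ x v, L.toFun x (σ x v) - v ∈ V.carrier x := by
  choose U hU hxU hUV hUc G R T hGR hGT hT hTs using fun x₀ => exists_straighten hLV hc x₀
  -- The local solution: `R` inverts the constant operator `G`, and `(T x₀ x).symm` converts this
  -- into a right inverse of the varying operator modulo the local model.
  let τ : ∀ x₀ x, E₂ x →ₗ[𝕜] E₁ x := fun x₀ x =>
    (chartSymm 𝕜 F₁ E₁ x₀ x ∘L ((T x₀ x).symm : F₁ →L[𝕜] F₁) ∘L R x₀ ∘L
      (V.straight x₀ x : F₂ →L[𝕜] F₂) ∘L chart 𝕜 F₂ E₂ x₀ x).toLinearMap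
  have hτ : ∀ x₀, ∀ x ∈ U x₀, ∀ v, L.toFun x (τ x₀ x v) - v ∈ V.carrier x := by
    intro x₀ x hx v
    rw [V.mem_carrier_iff_chart x₀ (hUV x₀ hx), map_sub, map_sub]
    have h : chart 𝕜 F₂ E₂ x₀ x (L.toFun x (τ x₀ x v)) =
        L.coord x₀ x ((T x₀ x).symm (R x₀ (V.straight x₀ x (chart 𝕜 F₂ E₂ x₀ x v)))) := rfl
    rw [h, ← Submodule.Quotient.mk_eq_zero, Submodule.Quotient.mk_sub, sub_eq_zero]
    have h' := hGT x₀ x hx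
      ((T x₀ x).symm (R x₀ (V.straight x₀ x (chart 𝕜 F₂ E₂ x₀ x v))))
    rw [ContinuousLinearEquiv.apply_symm_apply, hGR] at h'
    exact h'.symm
  have hτc : ∀ x₀, ∀ p : TotalSpace F₂ E₂, p.1 ∈ U x₀ →
      ContinuousAt (fun p : TotalSpace F₂ E₂ => (⟨p.1, τ x₀ p.1 p.2⟩ : TotalSpace F₁ E₁)) p := by
    intro x₀ p hp
    have hid : ContinuousAt (fun p : TotalSpace F₂ E₂ => p) p := continuousAt_id
    have hs := V.continuousAt_straight hid (hUV x₀ hp)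
    have hTs' := ((hTs x₀).continuousAt ((hU x₀).mem_nhds hp)).comp
      (f := fun p : TotalSpace F₂ E₂ => p.1) hid.totalSpace_proj
    exact hid.totalSpace_proj.chartSymm 𝕜
      (hTs'.clm_apply ((R x₀).continuous.continuousAt.comp hs)) (hUc x₀ hp)
  obtain ⟨t, ht⟩ := isCompact_univ.elim_finite_subcover U hU fun x _ => Set.mem_iUnion.2 ⟨x, hxU x⟩
  obtain ⟨ρ, hρU, hρ, -, -⟩ := exists_continuous_sum_one_of_isOpen_isCompact (X := X)
    (s := fun i : Fin t.card => U (t.equivFin.symm i)) (fun i => hU _) isCompact_univ fun x hx => by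
      obtain ⟨i, hi, hxi⟩ := Set.mem_iUnion₂.1 (ht hx)
      exact Set.mem_iUnion.2 ⟨t.equivFin ⟨i, hi⟩, by simpa using hxi⟩
  let y : Fin t.card → X := fun i => t.equivFin.symm i
  have hcont : ∀ s : Finset (Fin t.card), Continuous fun p : TotalSpace F₂ E₂ =>
      (⟨p.1, ∑ i ∈ s, ((ρ i p.1 : ℝ) : 𝕜) • τ (y i) p.1 p.2⟩ : TotalSpace F₁ E₁) := by
    classical
    intro s
    induction s using Finset.induction_on with
    | empty =>
      simp only [Finset.sum_empty]
      exact continuous_iff_continuousAt.2 fun p =>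
        ContinuousAt.totalSpace_zero 𝕜 (FiberBundle.continuous_proj F₂ E₂).continuousAt
    | insert i s hi ih =>
      simp only [Finset.sum_insert hi]
      refine Continuous.totalSpace_add 𝕜 (continuous_iff_continuousAt.2 fun p => ?_) ih
      by_cases hp : p.1 ∈ U (y i)
      · refine ContinuousAt.totalSpace_smul 𝕜 ?_ (hτc _ p hp)
        exact (RCLike.continuous_ofReal.comp ((ρ i).continuous.comp
          (FiberBundle.continuous_proj F₂ E₂))).continuousAt
      -- Outside `U (y i)` nothing is known about `τ`, but there the weight vanishes on a whole
      -- neighbourhood.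
      · have hp' : p.1 ∈ (tsupport (ρ i))ᶜ := fun h => hp (hρU i h)
        have hev : ∀ᶠ p : TotalSpace F₂ E₂ in 𝓝 p, p.1 ∈ (tsupport (ρ i))ᶜ :=
          (FiberBundle.continuous_proj F₂ E₂).continuousAt
            ((isClosed_tsupport _).isOpen_compl.mem_nhds hp')
        refine (ContinuousAt.totalSpace_zero 𝕜
          (FiberBundle.continuous_proj F₂ E₂).continuousAt).congr (hev.mono fun q hq => ?_)
        change (⟨q.1, 0⟩ : TotalSpace F₁ E₁) = ⟨q.1, ((ρ i q.1 : ℝ) : 𝕜) • τ (y i) q.1 q.2⟩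
        rw [image_eq_zero_of_notMem_tsupport hq, RCLike.ofReal_zero, zero_smul]
  refine ⟨fun x v => ∑ i, ((ρ i x : ℝ) : 𝕜) • τ (y i) x v, fun x => ⟨?_, ?_⟩, hcont Finset.univ, ?_⟩
  · intro v w
    simp only [map_add, smul_add, Finset.sum_add_distrib]
  · intro c v
    simp only [map_smul, Finset.smul_sum, smul_comm c]
  · intro x v
    have hone : ∑ i, ((ρ i x : ℝ) : 𝕜) = 1 := by
      have h := hρ (Set.mem_univ x)
      simp only [Finset.sum_apply, Pi.one_apply] at h
      exact_mod_cast congrArg (fun r : ℝ => (r : 𝕜)) h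
    -- Being a right inverse modulo `V` is an affine condition, so it survives averaging with
    -- weights of sum one.
    have hv : L.toFun x (∑ i, ((ρ i x : ℝ) : 𝕜) • τ (y i) x v) - v =
        ∑ i, ((ρ i x : ℝ) : 𝕜) • (L.toFun x (τ (y i) x v) - v) := by
      simp only [smul_sub, Finset.sum_sub_distrib, ← Finset.sum_smul, hone, one_smul, map_sum,
        map_smul]
    rw [hv]
    refine Submodule.sum_mem _ fun i _ => ?_
    by_cases hx : x ∈ U (y i)
    · exact Submodule.smul_mem _ _ (hτ _ x hx v)
    · rw [image_eq_zero_of_notMem_tsupport fun h => hx (hρU i h), RCLike.ofReal_zero, zero_smul]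
      exact Submodule.zero_mem _

end BanachMorphism

/-! ### Sections of infinite dimensional bundles in general position -/

section Generic

variable {𝕜 : Type w} [RCLike 𝕜] {X : Type u} [TopologicalSpace X]
  {F : Type*} [NormedAddCommGroup F] [NormedSpace 𝕜 F]
  {E : X → Type v} [∀ x, AddCommGroup (E x)] [∀ x, Module 𝕜 (E x)] [∀ x, TopologicalSpace (E x)]
  [TopologicalSpace (TotalSpace F E)] [FiberBundle F E] [VectorBundle 𝕜 F E]

/-- Local sections can be extended by means of a cutoff function. -/
theorem continuous_cutoff_smul_chartSymm {x₀ : X} {φ : C(X, ℝ)}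
    (hφ : tsupport φ ⊆ chartDom F E x₀) {T : Type*} [TopologicalSpace T] {b : T → X} {f : T → F}
    (hb : Continuous b) (hf : Continuous f) : Continuous fun t =>
      (⟨b t, ((φ (b t) : ℝ) : 𝕜) • chartSymm 𝕜 F E x₀ (b t) (f t)⟩ : TotalSpace F E) := by
  refine continuous_iff_continuousAt.2 fun t => ?_
  by_cases ht : b t ∈ chartDom F E x₀
  · exact ContinuousAt.totalSpace_smul 𝕜
      (RCLike.continuous_ofReal.comp (φ.continuous.comp hb)).continuousAt
      (hb.continuousAt.chartSymm 𝕜 hf.continuousAt ht)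
  · have hev : ∀ᶠ t in 𝓝 t, b t ∈ (tsupport φ)ᶜ :=
      hb.continuousAt ((isClosed_tsupport _).isOpen_compl.mem_nhds fun h => ht (hφ h))
    refine (ContinuousAt.totalSpace_zero 𝕜 hb.continuousAt).congr (hev.mono fun t ht => ?_)
    change (⟨b t, 0⟩ : TotalSpace F E) = ⟨b t, ((φ (b t) : ℝ) : 𝕜) • _⟩
    rw [image_eq_zero_of_notMem_tsupport ht, RCLike.ofReal_zero, zero_smul]

/-- A cutoff function is obtained as a partition of unity with a single member. -/
theorem exists_cutoff [CompactSpace X] [T2Space X] {Z U : Set X} (hZ : IsClosed Z) (hU : IsOpen U)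
    (hZU : Z ⊆ U) : ∃ φ : C(X, ℝ), tsupport φ ⊆ U ∧ ∀ x ∈ Z, φ x = 1 := by
  obtain ⟨f, hf, hf', -, -⟩ := exists_continuous_sum_one_of_isOpen_isCompact (X := X)
    (s := fun _ : Fin 1 => U) (fun _ => hU) hZ.isCompact fun x hx => Set.mem_iUnion.2 ⟨0, hZU hx⟩
  exact ⟨f 0, hf 0, fun x hx => by simpa using hf' hx⟩

variable [CompactSpace X] [T2Space X] [CompleteSpace F]

/-- The section is perturbed by a cutoff times the local section with constant coordinate `j`. Every
small `j` keeps it inside `O`, while the `j` for which it meets `W` over `Z` form a σ-compact set,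
so some small `j` is good. -/
theorem exists_section_notMem_of_isClosed (hF : ¬ FiniteDimensional 𝕜 F) {W : Subbundle 𝕜 F E}
    (hW : FiniteDimensional 𝕜 W.model) {x₀ : X} {Z : Set X} (hZ : IsClosed Z) (hZW : Z ⊆ W.dom x₀)
    {t : ∀ x, E x} (ht : Continuous fun x => (⟨x, t x⟩ : TotalSpace F E))
    {O : Set (TotalSpace F E)} (hO : IsOpen O) (htO : ∀ x, (⟨x, t x⟩ : TotalSpace F E) ∈ O) :
    ∃ s : ∀ x, E x, (Continuous fun x => (⟨x, s x⟩ : TotalSpace F E)) ∧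
      (∀ x, (⟨x, s x⟩ : TotalSpace F E) ∈ O) ∧ ∀ x ∈ Z, s x ∉ W.carrier x := by
  obtain ⟨φ, hφ, hφ₁⟩ := exists_cutoff hZ (W.isOpen_dom x₀) hZW
  have hφ' := hφ.trans (W.dom_subset_chartDom x₀)
  have hcont : Continuous fun q : F × X =>
      (⟨q.2, t q.2 + ((φ q.2 : ℝ) : 𝕜) • chartSymm 𝕜 F E x₀ q.2 q.1⟩ : TotalSpace F E) :=
    Continuous.totalSpace_add 𝕜 (ht.comp continuous_snd)
      (continuous_cutoff_smul_chartSymm hφ' continuous_snd continuous_fst)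
  -- Compactness of `X` makes one neighbourhood of `j = 0` work for all `x`.
  have hN : ∀ᶠ j in 𝓝 (0 : F), ∀ x ∈ (Set.univ : Set X),
      (⟨x, t x + ((φ x : ℝ) : 𝕜) • chartSymm 𝕜 F E x₀ x j⟩ : TotalSpace F E) ∈ O := by
    refine isCompact_univ.eventually_forall_of_forall_eventually fun x _ => ?_
    refine hcont.continuousAt.eventually_mem (hO.mem_nhds ?_)
    simpa using htO x
  have : CompactSpace Z := isCompact_iff_compactSpace.1 hZ.isCompact
  have : FiniteDimensional 𝕜 (W.locModel x₀) := (W.locEquiv x₀).toLinearEquiv.finiteDimensional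
  have : ProperSpace (W.locModel x₀) := FiniteDimensional.proper_rclike 𝕜 _
  -- Over `x ∈ Z` the perturbed section lies in `W` exactly when `j` is a vector of `W` minus `t x`
  -- in coordinates, so the bad `j` are parametrized by a compact space times a finite dimensional
  -- one.
  have hbad : IsSigmaCompact (Set.range fun q : Z × W.locModel x₀ =>
      (W.straight x₀ q.1).symm q.2 - chart 𝕜 F E x₀ q.1 (t q.1)) := by
    refine isSigmaCompact_range (continuous_iff_continuousAt.2 fun q => ?_)
    have hq : (q.1 : X) ∈ W.dom x₀ := hZW q.1.2
    have h₁ := ((W.continuousOn_straight_symm x₀).continuousAt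
      ((W.isOpen_dom x₀).mem_nhds hq)).comp (f := fun q : Z × W.locModel x₀ => (q.1 : X))
        (continuous_subtype_val.comp continuous_fst).continuousAt
    have h₂ := (ht.continuousAt (x := (q.1 : X))).chart 𝕜 (W.dom_subset_chartDom x₀ hq)
    exact (h₁.clm_apply (continuous_subtype_val.comp continuous_snd).continuousAt).sub
      (h₂.comp (f := fun q : Z × W.locModel x₀ => (q.1 : X))
        (continuous_subtype_val.comp continuous_fst).continuousAt)
  obtain ⟨j, hj, hjbad⟩ := hbad.exists_mem_nhds_notMem hF hN
  refine ⟨_, hcont.comp (Continuous.prodMk_right j), fun x => hj x (Set.mem_univ x),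
    fun x hx hxW => hjbad ?_⟩
  have hxd := hZW hx
  change t x + ((φ x : ℝ) : 𝕜) • chartSymm 𝕜 F E x₀ x j ∈ W.carrier x at hxW
  rw [W.mem_carrier_iff_chart x₀ hxd, hφ₁ x hx, RCLike.ofReal_one, one_smul, map_add,
    chart_chartSymm 𝕜 (W.dom_subset_chartDom x₀ hxd)] at hxW
  refine ⟨⟨⟨x, hx⟩, ⟨_, hxW⟩⟩, ?_⟩
  change (W.straight x₀ x).symm (W.straight x₀ x _) - _ = j
  rw [ContinuousLinearEquiv.symm_apply_apply, add_sub_cancel_left]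

/-- In an infinite dimensional bundle, every section can be approximated by sections which avoid a
given finite dimensional subbundle. -/
theorem exists_section_notMem (hF : ¬ FiniteDimensional 𝕜 F) {W : Subbundle 𝕜 F E}
    (hW : FiniteDimensional 𝕜 W.model)
    {t : ∀ x, E x} (ht : Continuous fun x => (⟨x, t x⟩ : TotalSpace F E))
    {O : Set (TotalSpace F E)} (hO : IsOpen O) (htO : ∀ x, (⟨x, t x⟩ : TotalSpace F E) ∈ O) :
    ∃ s : ∀ x, E x, (Continuous fun x => (⟨x, s x⟩ : TotalSpace F E)) ∧
      (∀ x, (⟨x, s x⟩ : TotalSpace F E) ∈ O) ∧ ∀ x, s x ∉ W.carrier x := by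
  have key : ∀ (t : ∀ x, E x) (O : Set (TotalSpace F E)),
      (Continuous fun x => (⟨x, t x⟩ : TotalSpace F E)) → IsOpen O →
      (∀ x, (⟨x, t x⟩ : TotalSpace F E) ∈ O) →
      ∃ s : ∀ x, E x, (Continuous fun x => (⟨x, s x⟩ : TotalSpace F E)) ∧
      (∀ x, (⟨x, s x⟩ : TotalSpace F E) ∈ O) ∧
      ∀ x ∈ closure (Set.univ : Set X), s x ∉ W.carrier x := by
    -- The claim is made for all `t` and `O`, so that one perturbation can start from the result of
    -- another, and over the closure of `Z`, so that what is achieved is an open condition.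
    refine isCompact_univ.induction_on (p := fun Z : Set X =>
      ∀ (t : ∀ x, E x) (O : Set (TotalSpace F E)),
      (Continuous fun x => (⟨x, t x⟩ : TotalSpace F E)) → IsOpen O →
      (∀ x, (⟨x, t x⟩ : TotalSpace F E) ∈ O) →
      ∃ s : ∀ x, E x, (Continuous fun x => (⟨x, s x⟩ : TotalSpace F E)) ∧
      (∀ x, (⟨x, s x⟩ : TotalSpace F E) ∈ O) ∧ ∀ x ∈ closure Z, s x ∉ W.carrier x)
      ?_ ?_ ?_ ?_
    · exact fun t O ht _ htO => ⟨t, ht, htO, by simp⟩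
    · intro Z Z' hZ h t O ht hO htO
      obtain ⟨s, hs, hsO, hsW⟩ := h t O ht hO htO
      exact ⟨s, hs, hsO, fun x hx => hsW x (closure_mono hZ hx)⟩
    · intro Z Z' h h' t O ht hO htO
      obtain ⟨s, hs, hsO, hsW⟩ := h t O ht hO htO
      -- Avoiding `W` over the closed set `closure Z` is built into the open set that controls the
      -- second perturbation, which therefore cannot spoil the first.
      have hclosed : IsClosed ({p : TotalSpace F E | p.1 ∈ closure Z} ∩
          {p : TotalSpace F E | p.2 ∈ W.carrier p.1}) :=
        (isClosed_closure.preimage (FiberBundle.continuous_proj F E)).inter W.isClosed_total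
      obtain ⟨s', hs', hsO', hsW'⟩ := h' s _ hs (hO.inter hclosed.isOpen_compl)
        fun x => ⟨hsO x, fun hx => hsW x hx.1 hx.2⟩
      refine ⟨s', hs', fun x => (hsO' x).1, fun x hx => ?_⟩
      rw [closure_union] at hx
      rcases hx with hx | hx
      · exact fun hxW => (hsO' x).2 ⟨hx, hxW⟩
      · exact hsW' x hx
    · intro x₀ _
      obtain ⟨Z, hZx, hZ, hZW⟩ := exists_mem_nhds_isClosed_subset
        ((W.isOpen_dom x₀).mem_nhds (W.mem_dom x₀))
      refine ⟨Z, mem_nhdsWithin_of_mem_nhds hZx, fun t O ht hO htO => ?_⟩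
      rw [hZ.closure_eq]
      exact exists_section_notMem_of_isClosed hF hW hZ hZW ht hO htO
  obtain ⟨s, hs, hsO, hsW⟩ := key t O ht hO htO
  exact ⟨s, hs, hsO, fun x => hsW x (subset_closure trivial)⟩

/-- A finite dimensional subbundle can be enlarged by the span of a section which avoids it. -/
theorem Subbundle.exists_sup_span {W : Subbundle 𝕜 F E} (hW : FiniteDimensional 𝕜 W.model)
    {s : ∀ x, E x} (hs : Continuous fun x => (⟨x, s x⟩ : TotalSpace F E))
    (hsW : ∀ x, s x ∉ W.carrier x) : ∃ W' : Subbundle 𝕜 F E,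
      W'.carrier = (fun x => W.carrier x ⊔ Submodule.span 𝕜 {s x}) ∧
      FiniteDimensional 𝕜 W'.model := by
  -- The frame of `W` with `s` as one additional vector; it is injective because `s x₀` is not in
  -- `W`.
  refine exists_of_frames _ (M := W.model × 𝕜) fun x₀ => ⟨W.dom x₀, W.isOpen_dom x₀, W.mem_dom x₀,
    W.dom_subset_chartDom x₀, fun x =>
      ((W.straight x₀ x).symm : F →L[𝕜] F) ∘L ((W.locModel x₀).subtypeL ∘L
        (W.locEquiv x₀).toContinuousLinearMap ∘L ContinuousLinearMap.fst 𝕜 W.model 𝕜) +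
      ContinuousLinearMap.smulRightL 𝕜 (W.model × 𝕜) F (ContinuousLinearMap.snd 𝕜 W.model 𝕜)
        (chart 𝕜 F E x₀ x (s x)), ?_, ?_, ?_⟩
  · refine ((W.continuousOn_straight_symm x₀).clm_comp continuousOn_const).add
      ((ContinuousLinearMap.continuous _).comp_continuousOn fun x hx => ?_)
    exact ((hs.continuousAt (x := x)).chart 𝕜 (W.dom_subset_chartDom x₀ hx)).continuousWithinAt
  · rw [injective_iff_map_eq_zero]
    rintro ⟨m, c⟩ h
    change (W.straight x₀ x₀).symm (W.locEquiv x₀ m) + c • chart 𝕜 F E x₀ x₀ (s x₀) = 0 at h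
    have hc : c = 0 := by
      by_contra hc
      apply hsW x₀
      rw [W.mem_carrier_iff_chart x₀ (W.mem_dom x₀)]
      have h' : chart 𝕜 F E x₀ x₀ (s x₀) = -(c⁻¹ • (W.straight x₀ x₀).symm (W.locEquiv x₀ m)) := by
        rw [eq_neg_of_add_eq_zero_left h, smul_neg, smul_smul, inv_mul_cancel₀ hc, one_smul,
          neg_neg]
      rw [h', map_neg, map_smul, ContinuousLinearEquiv.apply_symm_apply]
      exact Submodule.neg_mem _ (Submodule.smul_mem _ _ (Subtype.prop _))
    rw [hc, zero_smul, add_zero] at h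
    have hm : m = 0 := by simpa using h
    rw [hc, hm]
    rfl
  · intro x hx v
    have hxc := W.dom_subset_chartDom x₀ hx
    rw [Submodule.mem_sup]
    constructor
    · rintro ⟨a, ha, b, hb, rfl⟩
      obtain ⟨c, rfl⟩ := Submodule.mem_span_singleton.1 hb
      refine ⟨((W.locEquiv x₀).symm ⟨_, (W.mem_carrier_iff_chart x₀ hx a).1 ha⟩, c), ?_⟩
      change (W.straight x₀ x).symm (W.locEquiv x₀ ((W.locEquiv x₀).symm
        ⟨_, (W.mem_carrier_iff_chart x₀ hx a).1 ha⟩)) + c • chart 𝕜 F E x₀ x (s x) = _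
      rw [ContinuousLinearEquiv.apply_symm_apply, ContinuousLinearEquiv.symm_apply_apply, map_add,
        map_smul]
    · rintro ⟨⟨m, c⟩, h⟩
      change (W.straight x₀ x).symm (W.locEquiv x₀ m) + c • chart 𝕜 F E x₀ x (s x) = _ at h
      refine ⟨v - c • s x, ?_, c • s x, Submodule.mem_span_singleton.2 ⟨c, rfl⟩, by abel⟩
      rw [W.mem_carrier_iff_chart x₀ hx, map_sub, map_smul, ← h, add_sub_cancel_right,
        ContinuousLinearEquiv.apply_symm_apply]
      exact Subtype.prop _

end Generic

/-! ### Finite dimensional transversal subbundles -/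

/-- If `R` is a right inverse of `Φ y₀`, then `Φ y ∘ R` is close to the identity, hence invertible,
for `y` near `y₀`. -/
theorem ContinuousLinearMap.eventually_surjective {𝕜 : Type*} [RCLike 𝕜] {G F : Type*}
    [NormedAddCommGroup G] [NormedSpace 𝕜 G] [CompleteSpace G]
    [NormedAddCommGroup F] [NormedSpace 𝕜 F] [CompleteSpace F] {Y : Type*} [TopologicalSpace Y]
    {Φ : Y → (G →L[𝕜] F)} {y₀ : Y} (hΦ : ContinuousAt Φ y₀) (hs : Function.Surjective (Φ y₀))
    (hker : (Φ y₀).ker.ClosedComplemented) : ∀ᶠ y in 𝓝 y₀, Function.Surjective (Φ y) := by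
  obtain ⟨R, hR⟩ := (Φ y₀).exists_rightInverse_of_closedComplemented_ker hs hker
  have h₁ : Φ y₀ ∘L R = 1 := by
    ext g
    exact hR g
  have h₂ : ContinuousAt (fun y => Φ y ∘L R) y₀ := hΦ.clm_comp continuousAt_const
  have h₃ : ∀ᶠ y in 𝓝 y₀, IsUnit (Φ y ∘L R) := h₂.eventually_mem
    ((Units.isOpen (R := F →L[𝕜] F)).mem_nhds (show IsUnit (Φ y₀ ∘L R) from h₁ ▸ isUnit_one))
  filter_upwards [h₃] with y hy
  obtain ⟨S, hS⟩ := hy.exists_right_inv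
  exact fun g => ⟨R (S g), congrArg (fun A : F →L[𝕜] F => A g) hS⟩

namespace BanachMorphism

variable {𝕜 : Type w} [RCLike 𝕜] {X : Type u} [TopologicalSpace X]
  {F₁ : Type*} [NormedAddCommGroup F₁] [NormedSpace 𝕜 F₁] [CompleteSpace F₁]
  {E₁ : X → Type v} [∀ x, AddCommGroup (E₁ x)] [∀ x, Module 𝕜 (E₁ x)]
  [∀ x, TopologicalSpace (E₁ x)]
  [TopologicalSpace (TotalSpace F₁ E₁)] [FiberBundle F₁ E₁] [VectorBundle 𝕜 F₁ E₁]
  {F₂ : Type*} [NormedAddCommGroup F₂] [NormedSpace 𝕜 F₂] [CompleteSpace F₂]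
  {E₂ : X → Type v} [∀ x, AddCommGroup (E₂ x)] [∀ x, Module 𝕜 (E₂ x)]
  [∀ x, TopologicalSpace (E₂ x)]
  [∀ x, IsTopologicalAddGroup (E₂ x)] [∀ x, ContinuousSMul 𝕜 (E₂ x)]
  [TopologicalSpace (TotalSpace F₂ E₂)] [FiberBundle F₂ E₂] [VectorBundle 𝕜 F₂ E₂]
  {L : BanachMorphism 𝕜 F₁ E₁ F₂ E₂}

/-- Around `x₀`, the image of `L` is supplemented by any vectors whose coordinates are close to
those of a suitable finite family. -/
theorem exists_supplementing {x₀ : X} (hL : (L.toFun x₀).IsFredholm) :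
    ∃ (n : ℕ) (c : Fin n → F₂) (ε : ℝ) (U : Set X), 0 < ε ∧ IsOpen U ∧ x₀ ∈ U ∧
      U ⊆ chartDom F₂ E₂ x₀ ∧ ∀ x ∈ U, ∀ w : Fin n → E₂ x,
        (∀ i, chart 𝕜 F₂ E₂ x₀ x (w i) ∈ Metric.ball (c i) ε) →
        (L.toFun x).range ⊔ Submodule.span 𝕜 (Set.range w) = ⊤ := by
  have h₁ := mem_chartDom F₁ E₁ x₀
  have h₂ := mem_chartDom F₂ E₂ x₀
  have := hL.finite_ker
  have := hL.finite_coker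
  let b := Module.finBasis 𝕜 (E₂ x₀ ⧸ (L.toFun x₀).range)
  choose l hl using fun i => Submodule.Quotient.mk_surjective _ (b i)
  let n := Module.finrank 𝕜 (E₂ x₀ ⧸ (L.toFun x₀).range)
  let c : Fin n → F₂ := fun i => chart 𝕜 F₂ E₂ x₀ x₀ (l i)
  -- Base point and supplementing vectors vary together, so openness of surjectivity at `(x₀, c)`
  -- yields both the neighbourhood `U` and the tolerance `ε`.
  let Φ : X × (Fin n → F₂) → (F₁ × (Fin n → 𝕜) →L[𝕜] F₂) := fun y =>
    L.coord x₀ y.1 ∘L ContinuousLinearMap.fst 𝕜 F₁ (Fin n → 𝕜) + ∑ i,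
      ContinuousLinearMap.smulRightL 𝕜 (F₁ × (Fin n → 𝕜)) F₂
        (ContinuousLinearMap.proj i ∘L ContinuousLinearMap.snd 𝕜 F₁ (Fin n → 𝕜)) (y.2 i)
  have hΦ : ∀ y f a, Φ y (f, a) = L.coord x₀ y.1 f + ∑ i, a i • y.2 i := fun y f a => by
    simp [Φ]
  have hc : ContinuousAt Φ (x₀, c) := by
    refine ContinuousAt.add (ContinuousAt.clm_comp ?_ continuousAt_const) ?_
    · exact ContinuousAt.comp (f := Prod.fst) (g := L.coord x₀) (x := (x₀, c))
        ((L.continuousOn_coord x₀).continuousAt (((isOpen_chartDom F₁ E₁ x₀).inter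
          (isOpen_chartDom F₂ E₂ x₀)).mem_nhds ⟨h₁, h₂⟩)) continuousAt_fst
    · refine Continuous.continuousAt (continuous_finsetSum _ fun i _ => ?_)
      exact (ContinuousLinearMap.continuous _).comp ((_root_.continuous_apply i).comp continuous_snd)
  have hs : Function.Surjective (Φ (x₀, c)) := by
    intro g
    let v := chartSymm 𝕜 F₂ E₂ x₀ x₀ g
    let a : Fin n → 𝕜 := fun i => b.repr (Submodule.Quotient.mk v) i
    have hv : v - ∑ i, a i • l i ∈ (L.toFun x₀).range := by
      rw [← Submodule.Quotient.mk_eq_zero, Submodule.Quotient.mk_sub, sub_eq_zero]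
      rw [← Submodule.mkQ_apply _ (∑ i, a i • l i), map_sum]
      simp only [map_smul, Submodule.mkQ_apply, hl]
      exact (b.sum_repr _).symm
    obtain ⟨u, hu⟩ := hv
    refine ⟨(chart 𝕜 F₁ E₁ x₀ x₀ u, a), ?_⟩
    rw [hΦ, L.coord_chart h₁, show L.toFun x₀ u = v - ∑ i, a i • l i from hu, map_sub, map_sum,
      chart_chartSymm 𝕜 h₂]
    simp [c]
  -- The coefficients `a` range over a finite dimensional space, and kernel vectors with `a = 0`
  -- come from the kernel of `L`.
  have hk : FiniteDimensional 𝕜 (Φ (x₀, c)).ker := by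
    let p : (Φ (x₀, c)).ker →ₗ[𝕜] (Fin n → 𝕜) :=
      LinearMap.snd 𝕜 F₁ (Fin n → 𝕜) ∘ₗ (Φ (x₀, c)).ker.subtype
    have hp : ∀ q : p.ker, q.1.1.2 = 0 := fun q => q.2
    let κ : p.ker →ₗ[𝕜] (L.toFun x₀).ker :=
      ((chartSymm 𝕜 F₁ E₁ x₀ x₀).toLinearMap ∘ₗ LinearMap.fst 𝕜 F₁ (Fin n → 𝕜) ∘ₗ
        (Φ (x₀, c)).ker.subtype ∘ₗ p.ker.subtype).codRestrict _ fun q => by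
      have h : Φ (x₀, c) (q.1.1.1, q.1.1.2) = 0 := q.1.2
      rw [hp q, hΦ] at h
      simp only [Pi.zero_apply, zero_smul, Finset.sum_const_zero, add_zero] at h
      have h' := congrArg (chartSymm 𝕜 F₂ E₂ x₀ x₀) h
      rw [coord_apply, chartSymm_chart 𝕜 h₂, map_zero] at h'
      exact h'
    refine finiteDimensional_of_ker p (.of_injective κ ?_)
    rw [injective_iff_map_eq_zero]
    intro q hq
    have h : chartSymm 𝕜 F₁ E₁ x₀ x₀ q.1.1.1 = 0 := congrArg Subtype.val hq
    have h' := congrArg (chart 𝕜 F₁ E₁ x₀ x₀) h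
    rw [chart_chartSymm 𝕜 h₁, map_zero] at h'
    exact Subtype.ext (Subtype.ext (Prod.ext h' (hp q)))
  have hev := ContinuousLinearMap.eventually_surjective hc hs
    (Submodule.ClosedComplemented.of_finiteDimensional _)
  rw [nhds_prod_eq] at hev
  obtain ⟨P, hP, Q, hQ, hPQ⟩ := Filter.eventually_prod_iff.1 hev
  obtain ⟨ε, hε, hball⟩ := Metric.eventually_nhds_iff_ball.1 hQ
  obtain ⟨U, hUP, hU, hxU⟩ := eventually_nhds_iff.1 hP
  refine ⟨n, c, ε, U ∩ chartDom F₁ E₁ x₀ ∩ chartDom F₂ E₂ x₀, hε,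
    (hU.inter (isOpen_chartDom F₁ E₁ x₀)).inter (isOpen_chartDom F₂ E₂ x₀), ⟨⟨hxU, h₁⟩, h₂⟩,
    Set.inter_subset_right, ?_⟩
  rintro x ⟨⟨hx, hx₁⟩, hx₂⟩ w hw
  refine eq_top_iff.2 fun v _ => ?_
  obtain ⟨⟨f, a⟩, h⟩ := hPQ (hUP x hx) (hball (fun i => chart 𝕜 F₂ E₂ x₀ x (w i)) (by
    rw [Metric.mem_ball, dist_pi_lt_iff hε]
    exact hw)) (chart 𝕜 F₂ E₂ x₀ x v)
  rw [hΦ] at h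
  have h' := congrArg (chartSymm 𝕜 F₂ E₂ x₀ x) h
  rw [coord_apply, map_add, map_sum, chartSymm_chart 𝕜 hx₂, chartSymm_chart 𝕜 hx₂] at h'
  rw [← h']
  refine Submodule.add_mem_sup ⟨_, rfl⟩ (Submodule.sum_mem _ fun i _ => ?_)
  rw [map_smul, chartSymm_chart 𝕜 hx₂]
  exact Submodule.smul_mem _ _ (Submodule.subset_span ⟨i, rfl⟩)

end BanachMorphism

namespace Subbundle

variable {𝕜 : Type w} [RCLike 𝕜] {X : Type u} [TopologicalSpace X]
  {F : Type*} [NormedAddCommGroup F] [NormedSpace 𝕜 F]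
  {E : X → Type v} [∀ x, AddCommGroup (E x)] [∀ x, Module 𝕜 (E x)] [∀ x, TopologicalSpace (E x)]
  [TopologicalSpace (TotalSpace F E)] [FiberBundle F E] [VectorBundle 𝕜 F E]

variable (𝕜 F E) in
theorem exists_bot :
    ∃ W : Subbundle 𝕜 F E, (∀ x, W.carrier x = ⊥) ∧ FiniteDimensional 𝕜 W.model := by
  obtain ⟨W, hW, hW'⟩ := exists_of_adapted (𝕜 := 𝕜) (F := F) (E := E) (fun _ => ⊥) (fun _ => ⊥)
    (fun _ => by simp) (fun _ _ => ⟨.refl 𝕜 _⟩) fun x₀ => ⟨chartDom F E x₀, isOpen_chartDom F E x₀,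
      mem_chartDom F E x₀, subset_rfl, fun _ => .refl 𝕜 F, continuousOn_const, fun x hx v =>
        (chartEquiv 𝕜 F E hx).map_eq_zero_iff.symm⟩
  exact ⟨W, fun x => by rw [hW], hW' fun _ => inferInstance⟩

theorem exists_top (hF : FiniteDimensional 𝕜 F) :
    ∃ W : Subbundle 𝕜 F E, (∀ x, W.carrier x = ⊤) ∧ FiniteDimensional 𝕜 W.model := by
  obtain ⟨W, hW, hW'⟩ := exists_of_adapted (𝕜 := 𝕜) (F := F) (E := E) (fun _ => ⊤) (fun _ => ⊤)
    (fun _ => by simp) (fun _ _ => ⟨.refl 𝕜 _⟩) fun x₀ => ⟨chartDom F E x₀, isOpen_chartDom F E x₀,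
      mem_chartDom F E x₀, subset_rfl, fun _ => .refl 𝕜 F, continuousOn_const, fun x hx v =>
        by simp⟩
  exact ⟨W, fun x => by rw [hW], hW' fun _ => inferInstance⟩

variable [CompactSpace X] [T2Space X] [CompleteSpace F]

/-- Asking only for a vector near `c` leaves room to move the section with constant coordinate `c`
off `W`, so that the enlarged family is still a bundle. -/
theorem exists_le_mem_ball (hF : ¬ FiniteDimensional 𝕜 F) {W : Subbundle 𝕜 F E}
    (hW : FiniteDimensional 𝕜 W.model) {x₀ : X} {Z : Set X} (hZ : IsClosed Z)
    (hZc : Z ⊆ chartDom F E x₀) (c : F) {ε : ℝ} (hε : 0 < ε) :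
    ∃ W' : Subbundle 𝕜 F E, FiniteDimensional 𝕜 W'.model ∧ (∀ x, W.carrier x ≤ W'.carrier x) ∧
      ∀ x ∈ Z, ∃ w ∈ W'.carrier x, chart 𝕜 F E x₀ x w ∈ Metric.ball c ε := by
  obtain ⟨φ, hφ, hφ₁⟩ := exists_cutoff hZ (isOpen_chartDom F E x₀) hZc
  have ht := continuous_cutoff_smul_chartSymm (𝕜 := 𝕜) (f := fun _ => c) hφ continuous_id
    continuous_const
  -- The coordinate is constrained only over `Z`; elsewhere the cutoff section may be anything.
  have hO : IsOpen ({p : TotalSpace F E | p.1 ∉ Z} ∪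
      {p | p.1 ∈ chartDom F E x₀ ∧ chart 𝕜 F E x₀ p.1 p.2 ∈ Metric.ball c ε}) := by
    refine (hZ.isOpen_compl.preimage (FiberBundle.continuous_proj F E)).union
      (isOpen_iff_mem_nhds.2 fun p hp => ?_)
    have hid : ContinuousAt (fun p : TotalSpace F E => p) p := continuousAt_id
    exact Filter.inter_mem (hid.totalSpace_proj ((isOpen_chartDom F E x₀).mem_nhds hp.1))
      (hid.chart 𝕜 hp.1 (Metric.isOpen_ball.mem_nhds hp.2))
  obtain ⟨s, hs, hsO, hsW⟩ := exists_section_notMem hF hW ht hO fun x => by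
    by_cases hx : x ∈ Z
    · refine Or.inr ⟨hZc hx, ?_⟩
      change chart 𝕜 F E x₀ x (((φ x : ℝ) : 𝕜) • chartSymm 𝕜 F E x₀ x c) ∈ _
      rw [hφ₁ x hx, RCLike.ofReal_one, one_smul, chart_chartSymm 𝕜 (hZc hx)]
      exact Metric.mem_ball_self hε
    · exact Or.inl hx
  obtain ⟨W', hW', hfin⟩ := exists_sup_span hW hs hsW
  refine ⟨W', hfin, fun x => by rw [hW']; exact le_sup_left, fun x hx => ⟨s x, ?_, ?_⟩⟩
  · rw [hW']
    exact Submodule.mem_sup_right (Submodule.mem_span_singleton_self _)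
  · exact ((hsO x).resolve_left fun h => h hx).2

theorem exists_le_forall_mem_ball (hF : ¬ FiniteDimensional 𝕜 F) {W : Subbundle 𝕜 F E}
    (hW : FiniteDimensional 𝕜 W.model) {x₀ : X} {Z : Set X} (hZ : IsClosed Z)
    (hZc : Z ⊆ chartDom F E x₀) {ι : Type*} (c : ι → F) {ε : ℝ} (hε : 0 < ε) (t : Finset ι) :
    ∃ W' : Subbundle 𝕜 F E, FiniteDimensional 𝕜 W'.model ∧ (∀ x, W.carrier x ≤ W'.carrier x) ∧
      ∀ i ∈ t, ∀ x ∈ Z, ∃ w ∈ W'.carrier x, chart 𝕜 F E x₀ x w ∈ Metric.ball (c i) ε := by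
  classical
  induction t using Finset.induction_on with
  | empty => exact ⟨W, hW, fun _ => le_rfl, by simp⟩
  | insert i t _ ih =>
    obtain ⟨W₁, hW₁, hle, h₁⟩ := ih
    obtain ⟨W₂, hW₂, hle', h₂⟩ := exists_le_mem_ball hF hW₁ hZ hZc (c i) hε
    refine ⟨W₂, hW₂, fun x => (hle x).trans (hle' x), fun j hj x hx => ?_⟩
    rcases Finset.mem_insert.1 hj with rfl | hj
    · exact h₂ x hx
    · obtain ⟨w, hw, hw'⟩ := h₁ j hj x hx
      exact ⟨w, hle' x hw, hw'⟩

end Subbundle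

namespace BanachMorphism

variable {𝕜 : Type w} [RCLike 𝕜] {X : Type u} [TopologicalSpace X] [CompactSpace X] [T2Space X]
  {F₁ : Type*} [NormedAddCommGroup F₁] [NormedSpace 𝕜 F₁] [CompleteSpace F₁]
  {E₁ : X → Type v} [∀ x, AddCommGroup (E₁ x)] [∀ x, Module 𝕜 (E₁ x)]
  [∀ x, TopologicalSpace (E₁ x)]
  [TopologicalSpace (TotalSpace F₁ E₁)] [FiberBundle F₁ E₁] [VectorBundle 𝕜 F₁ E₁]
  {F₂ : Type*} [NormedAddCommGroup F₂] [NormedSpace 𝕜 F₂] [CompleteSpace F₂]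
  {E₂ : X → Type v} [∀ x, AddCommGroup (E₂ x)] [∀ x, Module 𝕜 (E₂ x)]
  [∀ x, TopologicalSpace (E₂ x)]
  [∀ x, IsTopologicalAddGroup (E₂ x)] [∀ x, ContinuousSMul 𝕜 (E₂ x)]
  [TopologicalSpace (TotalSpace F₂ E₂)] [FiberBundle F₂ E₂] [VectorBundle 𝕜 F₂ E₂]
  {L : BanachMorphism 𝕜 F₁ E₁ F₂ E₂}

/-- There are finite dimensional subbundles transversal to the image of a Fredholm morphism. -/
theorem exists_transversal (hL : L.IsFredholm) :
    ∃ W : Subbundle 𝕜 F₂ E₂, FiniteDimensional 𝕜 W.model ∧ L.Transversal W := by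
  obtain ⟨k, hk⟩ := hL
  -- General position needs infinite dimensions. Otherwise the whole bundle is a finite dimensional
  -- transversal subbundle.
  by_cases hF : FiniteDimensional 𝕜 F₂
  · obtain ⟨W, hW, hfin⟩ := Subbundle.exists_top (E := E₂) hF
    exact ⟨W, hfin, fun x => by rw [hW, sup_top_eq]⟩
  have key : ∀ W : Subbundle 𝕜 F₂ E₂, FiniteDimensional 𝕜 W.model →
      ∃ W' : Subbundle 𝕜 F₂ E₂, FiniteDimensional 𝕜 W'.model ∧
        (∀ x, W.carrier x ≤ W'.carrier x) ∧
        ∀ x ∈ (Set.univ : Set X), (L.toFun x).range ⊔ W'.carrier x = ⊤ := by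
    -- Starting from an arbitrary `W` and only enlarging it lets the results over two sets be
    -- combined: transversality is inherited by larger subbundles.
    refine isCompact_univ.induction_on (p := fun Z : Set X => ∀ W : Subbundle 𝕜 F₂ E₂,
      FiniteDimensional 𝕜 W.model → ∃ W' : Subbundle 𝕜 F₂ E₂, FiniteDimensional 𝕜 W'.model ∧
        (∀ x, W.carrier x ≤ W'.carrier x) ∧ ∀ x ∈ Z, (L.toFun x).range ⊔ W'.carrier x = ⊤)
      ?_ ?_ ?_ ?_
    · exact fun W hW => ⟨W, hW, fun _ => le_rfl, by simp⟩
    · intro Z Z' hZ h W hW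
      obtain ⟨W', hW', hle, h'⟩ := h W hW
      exact ⟨W', hW', hle, fun x hx => h' x (hZ hx)⟩
    · intro Z Z' h h' W hW
      obtain ⟨W₁, hW₁, hle, h₁⟩ := h W hW
      obtain ⟨W₂, hW₂, hle', h₂⟩ := h' W₁ hW₁
      refine ⟨W₂, hW₂, fun x => (hle x).trans (hle' x), fun x hx => ?_⟩
      rcases hx with hx | hx
      · exact top_le_iff.1 ((h₁ x hx).ge.trans (sup_le_sup_left (hle' x) _))
      · exact h₂ x hx
    · intro x₀ _
      obtain ⟨n, c, ε, U, hε, hU, hxU, hUc, hsup⟩ := exists_supplementing (hk x₀).1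
      obtain ⟨Z, hZx, hZ, hZU⟩ := exists_mem_nhds_isClosed_subset (hU.mem_nhds hxU)
      refine ⟨Z, mem_nhdsWithin_of_mem_nhds hZx, fun W hW => ?_⟩
      obtain ⟨W', hW', hle, h⟩ := Subbundle.exists_le_forall_mem_ball hF hW hZ (hZU.trans hUc) c hε
        Finset.univ
      refine ⟨W', hW', hle, fun x hx => top_le_iff.1 ?_⟩
      choose w hw hwc using fun i => h i (Finset.mem_univ i) x hx
      rw [← hsup x (hZU hx) w hwc]
      exact sup_le_sup_left (Submodule.span_le.2 (Set.range_subset_iff.2 hw)) _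
  obtain ⟨W₀, -, hW₀⟩ := Subbundle.exists_bot 𝕜 F₂ E₂
  obtain ⟨W, hW, -, h⟩ := key W₀ hW₀
  exact ⟨W, hW, fun x => h x trivial⟩

end BanachMorphism

/-! ### Classes of subbundles in `K(X)` -/

section Classes

variable {𝕜 : Type w} [RCLike 𝕜] {X : Type u} [TopologicalSpace X]

theorem KGroup.cls_sum (A B : FinVectorBundle.{v} 𝕜 X) :
    KGroup.cls (A.sum B) = KGroup.cls A + KGroup.cls B :=
  (Algebra.GrothendieckAddGroup.of (M := FinVectorBundle.Classes.{v} 𝕜 X)).map_add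
    (Quotient.mk _ A) (Quotient.mk _ B)

theorem KGroup.cls_congr {A B : FinVectorBundle.{v} 𝕜 X} (h : A.Isomorphic B) :
    KGroup.cls A = KGroup.cls B :=
  congrArg Algebra.GrothendieckAddGroup.of
    (show (Quotient.mk _ A : FinVectorBundle.Classes.{v} 𝕜 X) = Quotient.mk _ B from
      Quotient.sound h)

namespace Subbundle

variable {F : Type*} [NormedAddCommGroup F] [NormedSpace 𝕜 F] [CompleteSpace F]
  {E : X → Type v} [∀ x, AddCommGroup (E x)] [∀ x, Module 𝕜 (E x)] [∀ x, TopologicalSpace (E x)]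
  [TopologicalSpace (TotalSpace F E)] [FiberBundle F E] [VectorBundle 𝕜 F E]
  {S : Subbundle 𝕜 F E}

/-- A finite dimensional subbundle as a finite dimensional vector bundle. -/
abbrev toFin (hS : FiniteDimensional 𝕜 S.model) : FinVectorBundle.{v} 𝕜 X :=
  FinVectorBundle.ofVectorBundle hS S.Fiber

theorem continuous_toFin_iff {hS : FiniteDimensional 𝕜 S.model} {T : Type*} [TopologicalSpace T]
    {b : T → X} {f : ∀ t, S.Fiber (b t)} :
    Continuous (fun t => (⟨b t, f t⟩ : TotalSpace Unit (S.toFin hS).fib)) ↔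
      Continuous fun t => (⟨b t, S.incl (b t) (f t)⟩ : TotalSpace F E) :=
  continuous_induced_rng.trans S.continuous_fiber_iff

theorem continuous_toFin_incl (hS : FiniteDimensional 𝕜 S.model) :
    Continuous fun p : TotalSpace Unit (S.toFin hS).fib =>
      (⟨p.1, S.incl p.1 p.2⟩ : TotalSpace F E) :=
  continuous_toFin_iff (hS := hS) (b := fun p : TotalSpace Unit (S.toFin hS).fib => p.1)
    (f := fun p => p.2) |>.1 continuous_id

/-- A finite dimensional subbundle of a subbundle is a subbundle of the whole bundle. -/
theorem exists_map (W : Subbundle 𝕜 S.model S.Fiber) (hW : FiniteDimensional 𝕜 W.model) :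
    ∃ W' : Subbundle 𝕜 F E, (∀ x, W'.carrier x = (W.carrier x).map (S.incl x).toLinearMap) ∧
      FiniteDimensional 𝕜 W'.model := by
  refine (exists_of_frames (F := F) (fun x => (W.carrier x).map (S.incl x).toLinearMap)
    (M := W.model) fun x₀ => ?_).imp fun W' h => ⟨fun x => by rw [h.1], h.2⟩
  have hWS : W.dom x₀ ⊆ S.dom x₀ := W.dom_subset_chartDom x₀
  -- A local frame of `W` in the model of `S`, followed by the local frame of `S` in `F`.
  let A : X → W.model →L[𝕜] F := fun x => ((S.straight x₀ x).symm : F →L[𝕜] F) ∘L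
    ((S.locModel x₀).subtypeL ∘L (S.locEquiv x₀).toContinuousLinearMap) ∘L
    ((W.straight x₀ x).symm : S.model →L[𝕜] S.model) ∘L
    ((W.locModel x₀).subtypeL ∘L (W.locEquiv x₀).toContinuousLinearMap)
  have hA : ∀ x m, A x m = (S.straight x₀ x).symm (S.locEquiv x₀ ((W.straight x₀ x).symm
    (W.locEquiv x₀ m))) := fun _ _ => rfl
  refine ⟨W.dom x₀, W.isOpen_dom x₀, W.mem_dom x₀, hWS.trans (S.dom_subset_chartDom x₀), A,
    ?_, ?_, fun x hx v => ?_⟩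
  · exact ((S.continuousOn_straight_symm x₀).mono hWS).clm_comp (continuousOn_const.clm_comp
      ((W.continuousOn_straight_symm x₀).clm_comp continuousOn_const))
  · exact (S.straight x₀ x₀).symm.injective.comp (Subtype.val_injective.comp
      ((S.locEquiv x₀).injective.comp ((W.straight x₀ x₀).symm.injective.comp
        (Subtype.val_injective.comp (W.locEquiv x₀).injective))))
  · have hxS := S.dom_subset_chartDom x₀ (hWS hx)
    constructor
    · rintro ⟨u, hu, rfl⟩
      refine ⟨(W.locEquiv x₀).symm ⟨_, (W.mem_carrier_iff_chart x₀ hx u).1 hu⟩, ?_⟩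
      rw [hA, ContinuousLinearEquiv.apply_symm_apply, ContinuousLinearEquiv.symm_apply_apply]
      exact (S.chart_incl (hWS hx) u).symm
    · rintro ⟨m, hm⟩
      have hxW : x ∈ chartDom S.model S.Fiber x₀ := hWS hx
      refine ⟨chartSymm 𝕜 S.model S.Fiber x₀ x ((W.straight x₀ x).symm (W.locEquiv x₀ m)), ?_, ?_⟩
      · change _ ∈ W.carrier x
        rw [W.mem_carrier_iff_chart x₀ hx, chart_chartSymm 𝕜 hxW,
          ContinuousLinearEquiv.apply_symm_apply]
        exact Subtype.prop _
      · change S.incl x _ = v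
        rw [← chartSymm_chart 𝕜 hxS v, ← hm, hA, ← chartSymm_chart 𝕜 hxS (S.incl x _),
          S.chart_incl (hWS hx), chart_chartSymm 𝕜 hxW]

/-- The inclusion of `S` matches the two families fibrewise. Continuity into either total space can
be tested in the total space of `E`, where the identification changes nothing. -/
theorem kClass_map {W : Subbundle 𝕜 S.model S.Fiber} {W' : Subbundle 𝕜 F E}
    (h : ∀ x, W'.carrier x = (W.carrier x).map (S.incl x).toLinearMap)
    (hW : FiniteDimensional 𝕜 W.model) (hW' : FiniteDimensional 𝕜 W'.model) :
    W.kClass hW = W'.kClass hW' := by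
  let f : ∀ x, W.Fiber x ≃ₗ[𝕜] W'.Fiber x := fun x =>
    ((W.carrier x).equivMapOfInjective (S.incl x).toLinearMap (S.incl_injective x)).trans
      (LinearEquiv.ofEq _ _ (h x).symm)
  have hf : ∀ x u, W'.incl x (f x u) = S.incl x (W.incl x u) := fun _ _ => rfl
  refine KGroup.cls_congr ⟨f, continuous_toFin_iff.2 ?_,
    continuous_toFin_iff.2 (S.continuous_fiber_iff.2 ?_)⟩
  · exact S.continuous_incl.comp (continuous_toFin_incl hW)
  · refine (continuous_toFin_incl hW').congr fun p => ?_
    exact congrArg (fun v => (⟨p.1, v⟩ : TotalSpace F E))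
      ((congrArg (W'.incl p.1) ((f p.1).apply_symm_apply p.2).symm).trans (hf p.1 _))

end Subbundle

end Classes

/-! ### The exchange isomorphism -/

/-- The exchange isomorphism between `l⁻¹(W) × W'` and `l⁻¹(W') × W`. -/
def LinearMap.exchange {𝕜 A B : Type*} [Ring 𝕜] [AddCommGroup A] [Module 𝕜 A] [AddCommGroup B]
    [Module 𝕜 B] (l : A →ₗ[𝕜] B) {W W' : Submodule 𝕜 B} {D D' : Submodule 𝕜 A}
    (hD : D = W.comap l) (hD' : D' = W'.comap l) {σ σ' : B → A} (hσl : IsLinearMap 𝕜 σ)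
    (hσl' : IsLinearMap 𝕜 σ') (hσ : ∀ v, l (σ v) - v ∈ W) (hσ' : ∀ v, l (σ' v) - v ∈ W') :
    (D × W') ≃ₗ[𝕜] (D' × W) :=
  -- For `(d, w')` put `r = l d + l (σ w') - w'`, an element of `W`. The image is `(d + σ w' - σ' r,
  -- r)`, whose first entry is mapped by `l` to `w' - (l (σ' r) - r) ∈ W'`. Interchanging the roles
  -- of `σ` and `σ'` gives the inverse.
  have mem : ∀ p : D × W', l p.1 + l (σ p.2) - p.2 ∈ W := fun p => by
    rw [add_sub_assoc]
    exact W.add_mem (hD.le p.1.2) (hσ _)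
  have mem' : ∀ p : D' × W, l p.1 + l (σ' p.2) - p.2 ∈ W' := fun p => by
    rw [add_sub_assoc]
    exact W'.add_mem (hD'.le p.1.2) (hσ' _)
  { toFun := fun p => (⟨p.1 + σ p.2 - σ' (l p.1 + l (σ p.2) - p.2), by
        rw [hD', Submodule.mem_comap, map_sub, map_add]
        have h := W'.sub_mem p.2.2 (hσ' (l p.1 + l (σ p.2) - p.2))
        convert h using 1
        abel⟩, ⟨_, mem p⟩)
    invFun := fun p => (⟨p.1 + σ' p.2 - σ (l p.1 + l (σ' p.2) - p.2), by
        rw [hD, Submodule.mem_comap, map_sub, map_add]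
        have h := W.sub_mem p.2.2 (hσ (l p.1 + l (σ' p.2) - p.2))
        convert h using 1
        abel⟩, ⟨_, mem' p⟩)
    map_add' := fun p q => by
      ext
      · simp only [Prod.fst_add, Prod.snd_add, Submodule.coe_add, map_add, hσl.map_add,
          hσl'.map_add, hσl'.map_sub]
        abel
      · simp only [Prod.fst_add, Prod.snd_add, Submodule.coe_add, map_add, hσl.map_add]
        abel
    map_smul' := fun c p => by
      ext
      · simp only [Prod.smul_fst, Prod.smul_snd, Submodule.coe_smul, map_smul, hσl.map_smul,
          hσl'.map_add, hσl'.map_sub, hσl'.map_smul, RingHom.id_apply, smul_sub, smul_add]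
      · simp only [Prod.smul_fst, Prod.smul_snd, Submodule.coe_smul, map_smul, hσl.map_smul,
          RingHom.id_apply, smul_sub, smul_add]
    left_inv := fun p => by
      have h : l (p.1 + σ p.2 - σ' (l p.1 + l (σ p.2) - p.2)) +
          l (σ' (l p.1 + l (σ p.2) - p.2)) - (l p.1 + l (σ p.2) - p.2) = p.2 := by
        rw [map_sub, map_add]
        abel
      ext
      · simp only [h]
        abel
      · exact h
    right_inv := fun p => by
      have h : l (p.1 + σ' p.2 - σ (l p.1 + l (σ' p.2) - p.2)) +
          l (σ (l p.1 + l (σ' p.2) - p.2)) - (l p.1 + l (σ' p.2) - p.2) = p.2 := by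
        rw [map_sub, map_add]
        abel
      ext
      · simp only [h]
        abel
      · exact h }

/-! ### The index bundle -/

namespace BanachMorphism

variable {𝕜 : Type w} [RCLike 𝕜] {X : Type u} [TopologicalSpace X] [CompactSpace X] [T2Space X]
  {F₁ : Type*} [NormedAddCommGroup F₁] [NormedSpace 𝕜 F₁] [CompleteSpace F₁]
  {E₁ : X → Type v} [∀ x, AddCommGroup (E₁ x)] [∀ x, Module 𝕜 (E₁ x)]
  [∀ x, TopologicalSpace (E₁ x)]
  [TopologicalSpace (TotalSpace F₁ E₁)] [FiberBundle F₁ E₁] [VectorBundle 𝕜 F₁ E₁]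
  {F₂ : Type*} [NormedAddCommGroup F₂] [NormedSpace 𝕜 F₂] [CompleteSpace F₂]
  {E₂ : X → Type v} [∀ x, AddCommGroup (E₂ x)] [∀ x, Module 𝕜 (E₂ x)]
  [∀ x, TopologicalSpace (E₂ x)]
  [∀ x, IsTopologicalAddGroup (E₂ x)] [∀ x, ContinuousSMul 𝕜 (E₂ x)]
  [TopologicalSpace (TotalSpace F₂ E₂)] [FiberBundle F₂ E₂] [VectorBundle 𝕜 F₂ E₂]
  {L : BanachMorphism 𝕜 F₁ E₁ F₂ E₂}

/-- The forward map of the exchange isomorphism is continuous. -/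
theorem continuous_exchange {W W' : Subbundle 𝕜 F₂ E₂} {D D' : Subbundle 𝕜 F₁ E₁}
    (hD : FiniteDimensional 𝕜 D.model) (hD' : FiniteDimensional 𝕜 D'.model)
    (hW : FiniteDimensional 𝕜 W.model) (hW' : FiniteDimensional 𝕜 W'.model)
    {σ σ' : ∀ x, E₂ x → E₁ x}
    (hσ : Continuous fun p : TotalSpace F₂ E₂ => (⟨p.1, σ p.1 p.2⟩ : TotalSpace F₁ E₁))
    (hσ' : Continuous fun p : TotalSpace F₂ E₂ => (⟨p.1, σ' p.1 p.2⟩ : TotalSpace F₁ E₁))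
    {f : ∀ x, (D.Fiber x × W'.Fiber x) → D'.Fiber x × W.Fiber x}
    (hf₁ : ∀ x p, D'.incl x (f x p).1 = D.incl x p.1 + σ x (W'.incl x p.2) -
      σ' x (L.toFun x (D.incl x p.1) + L.toFun x (σ x (W'.incl x p.2)) - W'.incl x p.2))
    (hf₂ : ∀ x p, W.incl x (f x p).2 =
      L.toFun x (D.incl x p.1) + L.toFun x (σ x (W'.incl x p.2)) - W'.incl x p.2) :
    Continuous fun p : TotalSpace Unit ((D.toFin hD).sum (W'.toFin hW')).fib =>
      (⟨p.1, f p.1 p.2⟩ : TotalSpace Unit ((D'.toFin hD').sum (W.toFin hW)).fib) := by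
  have h₁ := (D.continuous_toFin_incl hD).comp (FinVectorBundle.continuous_fst _ (W'.toFin hW'))
  have h₂ := (W'.continuous_toFin_incl hW').comp (FinVectorBundle.continuous_snd (D.toFin hD) _)
  have h₃ := hσ.comp h₂
  have h₄ := Continuous.totalSpace_sub 𝕜 (Continuous.totalSpace_add 𝕜 (L.continuous_apply h₁)
    (L.continuous_apply h₃)) h₂
  have h₅ := Continuous.totalSpace_sub 𝕜 (Continuous.totalSpace_add 𝕜 h₁ h₃) (hσ'.comp h₄)
  refine FinVectorBundle.continuous_mk_sum
    (b := fun p : TotalSpace Unit ((D.toFin hD).sum (W'.toFin hW')).fib => p.1)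
    (A := D'.toFin hD') (B := W.toFin hW) (f := fun p => (f p.1 p.2).1)
    (g := fun p => (f p.1 p.2).2) (Subbundle.continuous_toFin_iff.2 ?_)
    (Subbundle.continuous_toFin_iff.2 ?_)
  · exact h₅.congr fun p => congrArg (fun v => (⟨p.1, v⟩ : TotalSpace F₁ E₁)) (hf₁ p.1 p.2).symm
  · exact h₄.congr fun p => congrArg (fun v => (⟨p.1, v⟩ : TotalSpace F₂ E₂)) (hf₂ p.1 p.2).symm

/-- The class `[E(L, W)] - [W]` does not depend on `W`. -/
theorem kClass_add_kClass (hL : L.IsFredholm) {W W' : Subbundle 𝕜 F₂ E₂} {D D' : Subbundle 𝕜 F₁ E₁}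
    (hLW : L.Transversal W) (hLW' : L.Transversal W')
    (hD : ∀ x, D.carrier x = L.preimage W x) (hD' : ∀ x, D'.carrier x = L.preimage W' x)
    (hfD : FiniteDimensional 𝕜 D.model) (hfD' : FiniteDimensional 𝕜 D'.model)
    (hfW : FiniteDimensional 𝕜 W.model) (hfW' : FiniteDimensional 𝕜 W'.model) :
    D.kClass hfD + W'.kClass hfW' = D'.kClass hfD' + W.kClass hfW := by
  obtain ⟨σ, hσl, hσc, hσ⟩ := exists_rightInverse_mod hLW (closedComplemented_preimage hL hfW)
  obtain ⟨σ', hσl', hσc', hσ'⟩ := exists_rightInverse_mod hLW' (closedComplemented_preimage hL hfW')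
  let f : ∀ x, (D.Fiber x × W'.Fiber x) ≃ₗ[𝕜] (D'.Fiber x × W.Fiber x) := fun x =>
    (L.toFun x).toLinearMap.exchange (hD x) (hD' x) (hσl x) (hσl' x) (hσ x) (hσ' x)
  refine (KGroup.cls_sum _ _).symm.trans ((KGroup.cls_congr ⟨f, ?_, ?_⟩).trans
    (KGroup.cls_sum _ _))
  · exact continuous_exchange (L := L) hfD hfD' hfW hfW' hσc hσc' (f := fun x => f x)
      (fun _ _ => rfl) fun _ _ => rfl
  -- The inverse is given by the same formulas with the two subbundles interchanged.
  · exact continuous_exchange (L := L) hfD' hfD hfW' hfW hσc' hσc (f := fun x => (f x).symm)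
      (fun _ _ => rfl) fun _ _ => rfl

/-- A Fredholm morphism has an index bundle. -/
theorem exists_hasIndexBundle [∀ x, IsTopologicalAddGroup (E₁ x)] [∀ x, ContinuousSMul 𝕜 (E₁ x)]
    (hL : L.IsFredholm) : ∃ κ, L.HasIndexBundle κ := by
  obtain ⟨W, hW, hLW⟩ := exists_transversal hL
  obtain ⟨D, hD, hfD⟩ := exists_subbundle_preimage hL hLW (closedComplemented_preimage hL hW)
  refine ⟨D.kClass (hfD hW) - W.kClass hW, ⟨W, hW, hLW⟩, fun W' hW' hLW' => ?_⟩
  obtain ⟨D', hD', hfD'⟩ := exists_subbundle_preimage hL hLW' (closedComplemented_preimage hL hW')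
  exact ⟨D', hfD' hW', hD', sub_eq_sub_iff_add_eq_add.2
    (kClass_add_kClass hL hLW hLW' hD hD' (hfD hW) (hfD' hW') hW hW')⟩

/-- For Fredholm morphisms the default value in `indexBundle` does not occur. -/
theorem hasIndexBundle_indexBundle [∀ x, IsTopologicalAddGroup (E₁ x)]
    [∀ x, ContinuousSMul 𝕜 (E₁ x)] (hL : L.IsFredholm) : L.HasIndexBundle L.indexBundle := by
  have h := exists_hasIndexBundle hL
  rw [indexBundle, dif_pos h]
  exact h.choose_spec

/-- The index bundle is not changed by restriction to the preimage of a transversal subbundle. -/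
theorem indexBundle_restrictPreimage [∀ x, IsTopologicalAddGroup (E₁ x)]
    [∀ x, ContinuousSMul 𝕜 (E₁ x)] (hL : L.IsFredholm) {V : Subbundle 𝕜 F₂ E₂}
    (hLV : L.Transversal V) {D : Subbundle 𝕜 F₁ E₁} (hD : ∀ x, D.carrier x = L.preimage V x) :
    L.indexBundle = (L.restrictPreimage V D hD).indexBundle := by
  have hLt := isFredholm_restrictPreimage hL hLV D hD
  have hind := hasIndexBundle_indexBundle hL
  obtain ⟨⟨W, hW, hLtW⟩, h⟩ := hasIndexBundle_indexBundle hLt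
  obtain ⟨W', hWW', hW'⟩ := Subbundle.exists_map W hW
  -- The image of `L` and `V` span everything, and `V` is spanned by `W` and the image of the
  -- restriction, which is contained in the image of `L`.
  have hLW' : L.Transversal W' := by
    refine fun x => eq_top_iff.2 ((hLV x).ge.trans (sup_le le_sup_left fun p hp => ?_))
    obtain ⟨_, ⟨d, rfl⟩, r, hr, hdr⟩ := Submodule.mem_sup.1
      (show (⟨p, hp⟩ : V.Fiber x) ∈ _ from (hLtW x).ge trivial)
    have hp' : L.toFun x (D.incl x d) + V.incl x r = p := congrArg (V.incl x) hdr
    rw [← hp', hWW']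
    exact Submodule.add_mem_sup ⟨D.incl x d, rfl⟩ ⟨r, hr, rfl⟩
  obtain ⟨D₁, hD₁, hcD₁, h₁⟩ := h W hW hLtW
  obtain ⟨D₂, hD₂, hcD₂, h₂⟩ := hind.2 W' hW' hLW'
  rw [h₁, h₂, Subbundle.kClass_map hWW' hW hW', Subbundle.kClass_map (fun x => ?_) hD₁ hD₂]
  rw [hcD₂, hcD₁]
  ext e
  rw [mem_preimage, hWW']
  constructor
  · rintro ⟨r, hr, hre⟩
    -- A vector sent by `L` into `W'`, hence into `V`, already lies in `D`; so the preimage of `W'`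
    -- under `L` is that of `W` under the restriction.
    have he : e ∈ D.carrier x := by
      rw [hD, mem_preimage, ← hre]
      exact V.incl_mem r
    refine ⟨⟨e, he⟩, ?_, rfl⟩
    have h : r = (L.restrictPreimage V D hD).toFun x ⟨e, he⟩ := V.incl_injective x hre
    exact (congrArg (fun s => s ∈ W.carrier x) h).mp hr
  · rintro ⟨d, hd, rfl⟩
    exact ⟨_, hd, rfl⟩

end BanachMorphism

end

/-- The two `HasIndexBundle` clauses ensure that the final equation compares genuine index bundles
and not default values. -/
theorem mainTheorem8 {𝕜 : Type w} [RCLike 𝕜]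
    {X : Type u} [TopologicalSpace X] [CompactSpace X] [T2Space X]
    {F₁ : Type y} [NormedAddCommGroup F₁] [NormedSpace 𝕜 F₁] [CompleteSpace F₁]
    {E₁ : X → Type v} [∀ x, AddCommGroup (E₁ x)] [∀ x, Module 𝕜 (E₁ x)]
    [∀ x, TopologicalSpace (E₁ x)]
    [∀ x, IsTopologicalAddGroup (E₁ x)] [∀ x, ContinuousSMul 𝕜 (E₁ x)]
    [TopologicalSpace (TotalSpace F₁ E₁)] [FiberBundle F₁ E₁] [VectorBundle 𝕜 F₁ E₁]
    {F₂ : Type z} [NormedAddCommGroup F₂] [NormedSpace 𝕜 F₂] [CompleteSpace F₂]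
    {E₂ : X → Type v} [∀ x, AddCommGroup (E₂ x)] [∀ x, Module 𝕜 (E₂ x)]
    [∀ x, TopologicalSpace (E₂ x)]
    [∀ x, IsTopologicalAddGroup (E₂ x)] [∀ x, ContinuousSMul 𝕜 (E₂ x)]
    [TopologicalSpace (TotalSpace F₂ E₂)] [FiberBundle F₂ E₂] [VectorBundle 𝕜 F₂ E₂]
    (L : BanachMorphism 𝕜 F₁ E₁ F₂ E₂) (hL : L.IsFredholm)
    (V : Subbundle 𝕜 F₂ E₂) (hV : V.IsDirect) (hLV : L.Transversal V)
    (hc : ∀ x, (L.preimage V x).ClosedComplemented) :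
    ∃ D : Subbundle 𝕜 F₁ E₁, (∀ x, D.carrier x = L.preimage V x) ∧ D.IsDirect ∧
      ∃ Lt : BanachMorphism 𝕜 D.model D.Fiber V.model V.Fiber,
        (∀ x (u : D.Fiber x), V.incl x (Lt.toFun x u) = L.toFun x (D.incl x u)) ∧
        Lt.IsFredholm ∧
        L.HasIndexBundle L.indexBundle ∧ Lt.HasIndexBundle Lt.indexBundle ∧
        L.indexBundle = Lt.indexBundle := by
  obtain ⟨D, hD, -⟩ := BanachMorphism.exists_subbundle_preimage hL hLV hc
  have hLt := BanachMorphism.isFredholm_restrictPreimage hL hLV D hD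
  exact ⟨D, hD, fun x => by rw [hD]; exact hc x, L.restrictPreimage V D hD, fun _ _ => rfl, hLt,
    BanachMorphism.hasIndexBundle_indexBundle hL, BanachMorphism.hasIndexBundle_indexBundle hLt,
    BanachMorphism.indexBundle_restrictPreimage hL hLV hD⟩
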